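/- Let $V$ be a finite non-empty set with $n$ elements and let $r\in V$. Consider the complete graph with self-loops on $V$, so that simple random walk moves at each step to a uniformly chosen element of $V$ (possibly the current vertex). **Aldous–Broder.** Let $(X_t)_{t\ge 0}$ be the simple random walk started at $X_0=r$, let $V_t=\{X_0,\dots,X_t\}$, and let $\eta=\inf\{t: V_t=V\}$ be the cover time. Put $\sigma^{\rm in}_0=0$ and, for $i\ge 1$, $$\sigma^{\rm out}_i=\inf\{t>\sigma^{\rm in}_{i-1}: X_t\notin V_{t-1}\}\wedge\eta,\qquad \sigma^{\rm in}_i=\inf\{t>\sigma^{\rm out}_i: X_t\in V_{t-1}\}\wedge\eta .$$ Let $\mathcal T^{AB}_t$ be the graph with vertex set $V_t$ and edge set $\{\{X_k,X_{k+1}\}: k<t,\ X_{k+1}\notin V_k\}$. **Wilson.** Start with the tree $(\{r\},\varnothing)$. As long as the current tree $(V',E')$ does not span $V$: choose $v\in V\setminus V'$ uniformly at random, run a simple random walk from $v$, independent of the past, until it first visits $V'$, and then add to the tree the vertices and edges of the chronological loop erasure of this walk (a branch). Time advances by one with each choice of a starting vertex and with each step of a walk; let $\mathcal T^{W}_t$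 be the tree built by time $t$. Let $\hat\sigma_0=0$ and, for $i\ge1$, let $\hat\sigma_i$ be the time at which the $i$-th branch is added to the tree, or the time at which the tree becomes spanning if there are fewer than $i$ branches. **Theorem.** For every $i\ge 0$, $\hat\sigma_i$ and $\sigma^{\rm in}_i$ are almost surely finite stopping times with respect to the filtrations generated by the run of Wilson's algorithm and by $(X_t)$, respectively, and $$\mathcal T^{W}_{\hat\sigma_i}\ \overset{d}{=}\ \mathcal T^{AB}_{\sigma^{\rm in}_i}$$ as random labelled trees, that is, as random pairs (vertex set, edge set). -/

import Mathlib

open MeasureTheory ProbabilityTheory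

noncomputable section

/-- An undirected graph on `V` without multiple edges, in which self-loops are allowed. -/
structure LoopGraph (V : Type*) where
  Adj : V → V → Prop
  symm : ∀ u v, Adj u v → Adj v u

/-- The complete graph with self-loops: any two vertices, distinct or not, are adjacent. -/
def LoopGraph.complete (V : Type*) : LoopGraph V where
  Adj _ _ := True
  symm _ _ _ := trivial

open Classical in
/-- The neighbours of `v`; `v` is among them iff there is a self-loop at `v`. -/
def LoopGraph.nbrs {V : Type*} [Fintype V] (G : LoopGraph V) (v : V) : Finset V :=
  Finset.univ.filter (G.Adj v)

open Classical in
/-- One step of simple random walk from `v`: a uniformly chosen neighbour of `v`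
(the walk stays put at a vertex without neighbours). -/
def LoopGraph.step {V : Type*} [Fintype V] (G : LoopGraph V) (v : V) : PMF V :=
  if h : (G.nbrs v).Nonempty then PMF.uniformOfFinset (G.nbrs v) h else PMF.pure v

/-- `X` is, under `P`, a time-homogeneous Markov chain with transition probabilities `K`,
started at `s₀`. The state space carries its discrete σ-algebra. -/
structure IsMarkovChain {Ω S : Type*} [MeasurableSpace Ω] [DecidableEq S] (P : Measure Ω)
    (K : S → PMF S) (s₀ : S) (X : ℕ → Ω → S) : Prop where
  measurable : ∀ t, Measurable[_, ⊤] (X t)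
  path_law : ∀ (n : ℕ) (x : ℕ → S), P {ω | ∀ k ≤ n, X k ω = x k} =
    (if x 0 = s₀ then 1 else 0) * ∏ k ∈ Finset.range n, K (x k) (x (k + 1))

/-- The filtration generated by a process with values in a discrete space. -/
def pastFiltration {Ω S : Type*} [m : MeasurableSpace Ω] (X : ℕ → Ω → S)
    (hX : ∀ t, Measurable[m, ⊤] (X t)) : Filtration ℕ m where
  seq t := ⨆ k ≤ t, MeasurableSpace.comap (X k) ⊤
  mono' _ _ h := iSup₂_mono' fun k hk => ⟨k, hk.trans h, le_rfl⟩
  le' _ := iSup₂_le fun k _ => (hX k).comap_le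

/-- `inf {t | p t}`, which is `⊤` (infinity) if there is no such `t`. -/
def firstTime (p : ℕ → Prop) : WithTop ℕ := ⨅ (t : ℕ) (_ : p t), (t : WithTop ℕ)

/-- A finite graph with labelled vertices in `V`, given by its vertex set and edge set. -/
@[ext]
structure PartialTree (V : Type*) where
  verts : Finset V
  edges : Finset (Sym2 V)
deriving DecidableEq

/-- Labelled partial trees carry the discrete σ-algebra. -/
instance (V : Type*) : MeasurableSpace (PartialTree V) := ⊤

/-! ### The Aldous–Broder algorithm

In this part `x : ℕ → V` is a trajectory of the walk. -/

namespace AldousBroder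

variable {V : Type*} [Fintype V] [DecidableEq V]

/-- The set `{x 0, …, x t}` of vertices visited up to time `t`. -/
def visited (x : ℕ → V) (t : ℕ) : Finset V := (Finset.range (t + 1)).image x

/-- The cover time. -/
def coverTime (x : ℕ → V) : WithTop ℕ := firstTime fun t => visited x t = Finset.univ

/-- The first time after `s` at which a vertex is visited for the first time,
capped at the cover time. -/
def outTime (x : ℕ → V) (s : WithTop ℕ) : WithTop ℕ :=
  firstTime (fun t => s < t ∧ x t ∉ visited x (t - 1)) ⊓ coverTime x

/-- The first time after `s` at which an already visited vertex is visited,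
capped at the cover time. -/
def inTime (x : ℕ → V) (s : WithTop ℕ) : WithTop ℕ :=
  firstTime (fun t => s < t ∧ x t ∈ visited x (t - 1)) ⊓ coverTime x

/-- The time `σⁱⁿ i` at which the `i`-th branch ends. -/
def sigmaIn (x : ℕ → V) : ℕ → WithTop ℕ
  | 0 => 0
  | i + 1 => inTime x (outTime x (sigmaIn x i))

/-- The tree of the first-entrance edges up to time `t`. -/
def tree (x : ℕ → V) (t : ℕ) : PartialTree V where
  verts := visited x t
  edges := ((Finset.range t).filter fun k => x (k + 1) ∉ visited x k).image
    fun k => s(x k, x (k + 1))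

end AldousBroder

/-! ### Wilson's algorithm -/

namespace Wilson

/-- A state of Wilson's algorithm: the tree built so far, and the trajectory so far of the random
walk that is under way (`[]` if none is). -/
@[ext]
structure State (V : Type*) where
  tree : PartialTree V
  walk : List V
deriving DecidableEq

variable {V : Type*} [Fintype V] [DecidableEq V]

/-- The chronological loop erasure of a walk: whenever the walk returns to a vertex `x` of the
current path, the path is cut back to `x`. -/
def loopErase (w : List V) : List V :=
  w.foldl (fun p x => p.takeWhile (fun y => decide (y ≠ x)) ++ [x]) []

/-- Add the vertices and the edges of a path to a tree. -/
def addPath (T : PartialTree V) (p : List V) : PartialTree V where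
  verts := T.verts ∪ p.toFinset
  edges := T.edges ∪ (List.zipWith (fun u v => s(u, v)) p p.tail).toFinset

/-- The walk under way moves to `x`. If `x` is in the tree then the walk stops and its loop
erasure is added to the tree. -/
def advance (s : State V) (x : V) : State V :=
  if x ∈ s.tree.verts then ⟨addPath s.tree (loopErase (s.walk ++ [x])), []⟩
  else ⟨s.tree, s.walk ++ [x]⟩

/-- The tree `({r}, ∅)`, and no walk under way. -/
def init (r : V) : State V := ⟨⟨{r}, ∅⟩, []⟩

/-- One step of Wilson's algorithm. If the tree is spanning then the algorithm has ended. Otherwise,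
if no walk is under way, one is started at a vertex chosen uniformly among those that are not in
the tree; and if a walk is under way, it makes one step of simple random walk on `G`. -/
def step (G : LoopGraph V) (s : State V) : PMF (State V) :=
  if h : (s.tree.verts)ᶜ.Nonempty then
    match s.walk.getLast? with
    | none => (PMF.uniformOfFinset _ h).map fun v => ⟨s.tree, [v]⟩
    | some u => (G.step u).map (advance s)
  else PMF.pure s

/-- The time at which the tree becomes spanning along the run `w`. -/
def endTime (w : ℕ → State V) : WithTop ℕ := firstTime fun t => (w t).tree.verts = Finset.univ

/-- The time `σ̂ i` at which the `i`-th branch is completed along the run `w`, capped at the end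
of the algorithm. -/
def sigmaHat (w : ℕ → State V) : ℕ → WithTop ℕ
  | 0 => 0
  | i + 1 => firstTime (fun t => sigmaHat w i < t ∧ (w t).walk = []) ⊓ endTime w

end Wilson

end

/-
Let `T` be a partial tree, and let a *fresh run* out of `T` be the sequence of vertices that are met
by independent uniform draws before the first draw that lies in `T` or repeats an earlier one. Its
probability of being a given sequence of distinct vertices outside `T` depends on the length only,
so the law of a nonempty fresh run is invariant under reversal.

In the Aldous–Broder algorithm the walk is at a uniform vertex of `T` when it sets out on a new
branch, which is then this vertex followed by a nonempty fresh run. In Wilson's algorithm the loop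
erasure of the walk, read from its uniform starting point towards `T`, is a nonempty fresh run
followed by a uniform vertex of `T`: this follows by solving the one-step equations for the law of
the completed branch given the loop erasure so far (`walkLaw`). So the two branches differ by a
reversal, and the edges of a path do not depend on the direction in which it is read.

In both algorithms the conditional law of the tree at the `i`-th stopping time, given the past, is
an explicit function of the past. Its masses are bounded martingales, as one checks in one step of
the chain, so optional stopping identifies the law of the stopped tree with that of the `i`-th term
of one and the same chain of partial trees.
-/

noncomputable section

open scoped ENNReal

theorem succ_le_iff_natCast_lt {a : WithTop ℕ} {t : ℕ} : ((t + 1 : ℕ) : WithTop ℕ) ≤ a ↔ t < a :=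
  ENat.add_one_le_iff (n := a) (ENat.natCast_ne_top t)

theorem tendsto_stoppedProcess {Ω E : Type*} [TopologicalSpace E] {u : ℕ → Ω → E}
    {τ : Ω → WithTop ℕ} {ω : Ω} (hω : τ ω < ⊤) :
    Filter.Tendsto (fun t => stoppedProcess u τ t ω) Filter.atTop (nhds (stoppedValue u τ ω)) := by
  obtain ⟨s, hs⟩ := WithTop.ne_top_iff_exists.1 hω.ne
  refine tendsto_const_nhds.congr' ?_
  filter_upwards [Filter.eventually_ge_atTop s] with t ht
  exact (stoppedProcess_eq_of_ge (hs.symm.le.trans (WithTop.coe_le_coe.2 ht))).symm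

section Path

variable {Ω S : Type*} [m : MeasurableSpace Ω] [Countable S] {X : ℕ → Ω → S}

theorem measurable_pastFiltration_of_dependsOn {β : Type*} [MeasurableSpace β]
    (hX : ∀ t, Measurable[m, ⊤] (X t)) {t : ℕ} {f : (ℕ → S) → β} (hf : DependsOn f (Set.Iic t)) :
    Measurable[pastFiltration X hX t] fun ω => f fun k => X k ω := by
  let _ : MeasurableSpace S := ⊤
  rcases isEmpty_or_nonempty Ω with _ | ⟨⟨ω₀⟩⟩
  · exact @measurable_of_empty _ _ (_) _ _ _
  have : Nonempty β := ⟨f fun k => X k ω₀⟩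
  obtain ⟨g, rfl⟩ := dependsOn_iff_exists_comp.1 hf
  have hR : Measurable[pastFiltration X hX t] fun ω => (Set.Iic t).domRestrict fun k => X k ω := by
    refine @measurable_pi_lambda _ _ _ (_) _ _ fun k => Measurable.of_comap_le ?_
    exact le_iSup₂_of_le (f := fun j (_ : j ≤ t) => MeasurableSpace.comap (X j) ⊤) k.1 k.2 le_rfl
  exact Measurable.of_discrete.comp hR

theorem measurable_of_dependsOn {β : Type*} [MeasurableSpace β]
    (hX : ∀ t, Measurable[m, ⊤] (X t)) {t : ℕ} {f : (ℕ → S) → β} (hf : DependsOn f (Set.Iic t)) :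
    Measurable fun ω => f fun k => X k ω :=
  (measurable_pastFiltration_of_dependsOn hX hf).mono ((pastFiltration X hX).le t) le_rfl

theorem lintegral_eq_of_cylinder_eq (hX : ∀ t, Measurable[_, ⊤] (X t)) {μ ν : Measure Ω} {t : ℕ}
    (hμν : ∀ x : ℕ → S, μ {ω | ∀ k ≤ t, X k ω = x k} = ν {ω | ∀ k ≤ t, X k ω = x k})
    {φ : (ℕ → S) → ℝ≥0∞} (hφ : DependsOn φ (Set.Iic t)) :
    ∫⁻ ω, φ (fun k => X k ω) ∂μ = ∫⁻ ω, φ (fun k => X k ω) ∂ν := by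
  let _ : MeasurableSpace S := ⊤
  let R : Ω → (Set.Iic t → S) := fun ω k => X k ω
  have hR : Measurable R := measurable_pi_lambda _ fun k => hX k
  have hpre (x : ℕ → S) : R ⁻¹' {fun k : Set.Iic t => x k} = {ω | ∀ k ≤ t, X k ω = x k} := by
    ext ω
    simp [R, funext_iff]
  have hmap : μ.map R = ν.map R := by
    refine Measure.ext_of_singleton fun a => ?_
    have : Nonempty S := ⟨a ⟨t, Set.self_mem_Iic⟩⟩
    obtain ⟨x, rfl⟩ : ∃ x : ℕ → S, (fun k : Set.Iic t => x k) = a :=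
      Subtype.surjective_restrict (α := ℕ) (β := fun _ => S) (· ∈ Set.Iic t) a
    rw [Measure.map_apply hR (measurableSet_singleton _),
      Measure.map_apply hR (measurableSet_singleton _), hpre, hμν]
  obtain ⟨g, rfl⟩ := dependsOn_iff_exists_comp.1 hφ
  calc ∫⁻ ω, g (R ω) ∂μ = ∫⁻ a, g a ∂μ.map R := (lintegral_map Measurable.of_discrete hR).symm
    _ = ∫⁻ a, g a ∂ν.map R := by rw [hmap]
    _ = ∫⁻ ω, g (R ω) ∂ν := lintegral_map Measurable.of_discrete hR

end Path

/-- A sequence of functionals of a trajectory of which the `t`-th depends on the trajectory up to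
time `t` only. For a random time `τ` the condition `IsNonanticipating fun t x => τ x ≤ t` says that
`τ` is a stopping time. -/
def IsNonanticipating {S β : Type*} (f : ℕ → (ℕ → S) → β) : Prop :=
  ∀ t, DependsOn (f t) (Set.Iic t)

namespace IsNonanticipating

section

variable {S β : Type*} {f : ℕ → (ℕ → S) → β} {τ : (ℕ → S) → WithTop ℕ}

theorem dependsOn_of_le (hf : IsNonanticipating f) {s t : ℕ} (h : s ≤ t) :
    DependsOn (f s) (Set.Iic t) :=
  (hf s).mono (Set.Iic_subset_Iic.2 h)

theorem update_of_le (hf : IsNonanticipating f) {s t : ℕ} (h : s ≤ t) (x : ℕ → S) (a : S) :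
    f s (Function.update x (t + 1) a) = f s x :=
  hf s fun k hk => Function.update_of_ne (by grind) _ _

theorem min_eq (hτ : IsNonanticipating fun t x => τ x ≤ t) {t : ℕ} {x y : ℕ → S}
    (hxy : ∀ k ∈ Set.Iic t, x k = y k) : min ↑t (τ x) = min ↑t (τ y) := by
  refine eq_of_forall_ge_iff fun c => ?_
  rw [min_le_iff, min_le_iff]
  induction c using WithTop.recTopCoe with
  | top => simp
  | coe c =>
    rcases le_total t c with htc | hct
    · simp [Nat.cast_le.2 htc]
    · have : (τ x ≤ c) = (τ y ≤ c) := hτ.dependsOn_of_le hct hxy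
      exact or_congr_right this.to_iff

theorem stoppedProcess (hf : IsNonanticipating f) (hτ : IsNonanticipating fun t x => τ x ≤ t) :
    IsNonanticipating (stoppedProcess f τ) := by
  intro t x y hxy
  have hle : (min ↑t (τ x)).untopA ≤ t :=
    WithTop.untopA_le (min_le_left _ _)
  exact (hf.dependsOn_of_le hle hxy).trans
    (congrArg (fun s : WithTop ℕ => f s.untopA y) (hτ.min_eq hxy))

end

section

variable {Ω S β : Type*} [m : MeasurableSpace Ω] [Countable S] [MeasurableSpace β]
  {X : ℕ → Ω → S} {f : ℕ → (ℕ → S) → β} {τ : (ℕ → S) → WithTop ℕ}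

theorem isStoppingTime (hτ : IsNonanticipating fun t x => τ x ≤ t)
    (hX : ∀ t, Measurable[m, ⊤] (X t)) :
    IsStoppingTime (pastFiltration X hX) fun ω => τ fun k => X k ω :=
  fun t => @Measurable.setOf _ (_) _ (measurable_pastFiltration_of_dependsOn hX (hτ t))

theorem measurable_stoppedValue (hf : IsNonanticipating f)
    (hτ : IsNonanticipating fun t x => τ x ≤ t) (hX : ∀ t, Measurable[m, ⊤] (X t)) :
    Measurable (stoppedValue (fun t ω => f t fun k => X k ω) fun ω => τ fun k => X k ω) := by
  have hτX : Measurable fun ω => (τ fun k => X k ω).untopA :=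
    Measurable.of_discrete.comp (hτ.isStoppingTime hX).measurable'
  have hfX : Measurable fun q : Ω × ℕ => f q.2 fun k => X k q.1 :=
    measurable_from_prod_countable_left fun t => measurable_of_dependsOn hX (hf t)
  exact hfX.comp (measurable_id.prodMk hτX)

end

end IsNonanticipating

namespace IsMarkovChain

variable {Ω S : Type*} [MeasurableSpace Ω] [DecidableEq S] {P : Measure Ω} {K : S → PMF S}
  {s₀ : S} {X : ℕ → Ω → S}

theorem measurableSet_eq (hX : IsMarkovChain P K s₀ X) (t : ℕ) (s : S) :
    MeasurableSet {ω | X t ω = s} :=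
  hX.measurable t (MeasurableSpace.measurableSet_top (s := {s}))

theorem ae_initial [IsProbabilityMeasure P] (hX : IsMarkovChain P K s₀ X) :
    ∀ᵐ ω ∂P, X 0 ω = s₀ := by
  have h := hX.path_law 0 fun _ => s₀
  simp only [if_true, Finset.range_zero, Finset.prod_empty, mul_one, nonpos_iff_eq_zero,
    forall_eq] at h
  exact (prob_compl_eq_zero_iff (hX.measurableSet_eq 0 s₀)).2 h

theorem measure_cylinder_succ (hX : IsMarkovChain P K s₀ X) (t : ℕ) (x : ℕ → S) (s : S) :
    P ({ω | ∀ k ≤ t, X k ω = x k} ∩ {ω | X (t + 1) ω = s}) =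
      P {ω | ∀ k ≤ t, X k ω = x k} * K (x t) s := by
  have hset : {ω | ∀ k ≤ t, X k ω = x k} ∩ {ω | X (t + 1) ω = s} =
      {ω | ∀ k ≤ t + 1, X k ω = Function.update x (t + 1) s k} := by
    ext ω
    simp only [Set.mem_inter_iff, Set.mem_ofPred_eq, Nat.le_succ_iff]
    grind
  have hprod : ∏ k ∈ Finset.range t, K (Function.update x (t + 1) s k)
      (Function.update x (t + 1) s (k + 1)) = ∏ k ∈ Finset.range t, K (x k) (x (k + 1)) :=
    Finset.prod_congr rfl fun k hk => by
      have := Finset.mem_range.1 hk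
      rw [Function.update_of_ne (by lia), Function.update_of_ne (by lia)]
  rw [hset, hX.path_law, hX.path_law, Finset.prod_range_succ, hprod, Function.update_self,
    Function.update_of_ne (by lia), Function.update_of_ne (by lia), mul_assoc]

variable [Countable S]

theorem setLIntegral_succ (hX : IsMarkovChain P K s₀ X) (t : ℕ) (s : S) {ψ : (ℕ → S) → ℝ≥0∞}
    (hψ : DependsOn ψ (Set.Iic t)) :
    ∫⁻ ω in {ω | X (t + 1) ω = s}, ψ (fun k => X k ω) ∂P =
      ∫⁻ ω, K (X t ω) s * ψ (fun k => X k ω) ∂P := by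
  let _ : MeasurableSpace S := ⊤
  have hK : Measurable fun ω => K (X t ω) s :=
    (Measurable.of_discrete (f := fun a => K a s)).comp (hX.measurable t)
  have hcyl (x : ℕ → S) : MeasurableSet {ω | ∀ k ≤ t, X k ω = x k} := by
    simp only [Set.ofPred_forall]
    exact .iInter fun k => .iInter fun _ => hX.measurableSet_eq k (x k)
  have hψX : Measurable fun ω => ψ fun k => X k ω :=
    measurable_of_dependsOn hX.measurable hψ
  rw [lintegral_eq_of_cylinder_eq hX.measurable (ν := P.withDensity fun ω => K (X t ω) s)
    (fun x => ?_) hψ, lintegral_withDensity_eq_lintegral_mul _ hK hψX]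
  · rfl
  · rw [Measure.restrict_apply (hcyl x), hX.measure_cylinder_succ, withDensity_apply _ (hcyl x),
      mul_comm, ← setLIntegral_const]
    exact setLIntegral_congr_fun (hcyl x) fun ω hω => by rw [hω t le_rfl]

theorem lintegral_succ (hX : IsMarkovChain P K s₀ X) (t : ℕ) {φ : (ℕ → S) → ℝ≥0∞}
    (hφ : DependsOn φ (Set.Iic (t + 1))) :
    ∫⁻ ω, φ (fun k => X k ω) ∂P =
      ∫⁻ ω, ∑' s, K (X t ω) s * φ (Function.update (fun k => X k ω) (t + 1) s) ∂P := by
  let _ : MeasurableSpace S := ⊤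
  have hφs (s : S) : DependsOn (fun x => φ (Function.update x (t + 1) s)) (Set.Iic t) := by
    refine fun x y hxy => hφ fun k hk => ?_
    rcases eq_or_ne k (t + 1) with rfl | hne
    · simp
    · simp [hne, hxy k (Nat.le_of_lt_succ (lt_of_le_of_ne hk hne))]
  have hfiber (s : S) : ∫⁻ ω in {ω | X (t + 1) ω = s}, φ (fun k => X k ω) ∂P =
      ∫⁻ ω, K (X t ω) s * φ (Function.update (fun k => X k ω) (t + 1) s) ∂P := by
    rw [← hX.setLIntegral_succ t s (hφs s)]
    refine setLIntegral_congr_fun (hX.measurableSet_eq _ _) fun ω hω => congrArg φ ?_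
    exact (Function.update_eq_self_iff.2 (Set.mem_ofPred_eq ▸ hω).symm).symm
  have hcover : ⋃ s, {ω | X (t + 1) ω = s} = Set.univ := by
    ext ω
    simp
  have hdisj : Pairwise (Function.onFun Disjoint fun s => {ω | X (t + 1) ω = s}) :=
    fun s s' hss => Set.disjoint_left.2 fun ω hω hω' => hss (hω.symm.trans hω')
  rw [← setLIntegral_univ, ← hcover, lintegral_iUnion (hX.measurableSet_eq (t + 1)) hdisj,
    lintegral_tsum fun s => ?_]
  · exact tsum_congr hfiber
  · exact (((Measurable.of_discrete (f := fun a => K a s)).comp (hX.measurable t)).mul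
      (measurable_of_dependsOn hX.measurable (hφs s))).aemeasurable

theorem ae_transition_ne_zero (hX : IsMarkovChain P K s₀ X) :
    ∀ᵐ ω ∂P, ∀ t, K (X t ω) (X (t + 1) ω) ≠ 0 := by
  classical
  refine ae_all_iff.2 fun t => ?_
  let φ : (ℕ → S) → ℝ≥0∞ := fun x => if K (x t) (x (t + 1)) = 0 then 1 else 0
  have hφ : DependsOn φ (Set.Iic (t + 1)) := fun x y h => by
    simp only [φ, h t (Set.mem_Iic.2 t.le_succ), h (t + 1) Set.self_mem_Iic]
  have hzero : ∫⁻ ω, φ (fun k => X k ω) ∂P = 0 := by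
    rw [hX.lintegral_succ t hφ]
    refine (lintegral_congr fun ω => ENNReal.tsum_eq_zero.2 fun s => ?_).trans lintegral_zero
    by_cases hK : K (X t ω) s = 0 <;> simp [φ, hK]
  rw [lintegral_eq_zero_iff (measurable_of_dependsOn hX.measurable hφ)] at hzero
  filter_upwards [hzero] with ω hω hK
  simp [φ, hK] at hω

theorem ae_invariant [IsProbabilityMeasure P] (hX : IsMarkovChain P K s₀ X) {I : S → Prop}
    (h₀ : I s₀) (hI : ∀ s s', I s → K s s' ≠ 0 → I s') : ∀ᵐ ω ∂P, ∀ t, I (X t ω) := by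
  filter_upwards [hX.ae_initial, hX.ae_transition_ne_zero] with ω hω₀ hK t
  induction t with
  | zero => rwa [hω₀]
  | succ t ih => exact hI _ _ ih (hK t)

section Stopping

variable {τ : (ℕ → S) → WithTop ℕ} (hτ : IsNonanticipating fun t x => τ x ≤ t)

include hτ

theorem lintegral_stoppedProcess_succ (hX : IsMarkovChain P K s₀ X)
    {ψ : ℕ → (ℕ → S) → ℝ≥0∞} (hψ : IsNonanticipating ψ) (t : ℕ) :
    ∫⁻ ω, stoppedProcess ψ τ (t + 1) (fun k => X k ω) ∂P =
      ∫⁻ ω, if t < τ (fun k => X k ω)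
        then ∑' s, K (X t ω) s * ψ (t + 1) (Function.update (fun k => X k ω) (t + 1) s)
        else stoppedProcess ψ τ t (fun k => X k ω) ∂P := by
  rw [hX.lintegral_succ t (hψ.stoppedProcess hτ (t + 1))]
  refine lintegral_congr fun ω => ?_
  have hτ_update (s : S) :
      τ (Function.update (fun k => X k ω) (t + 1) s) ≤ t ↔ τ (fun k => X k ω) ≤ t :=
    (hτ.update_of_le le_rfl (fun k => X k ω) s).to_iff
  split_ifs with h
  · refine tsum_congr fun s => congrArg _ (stoppedProcess_eq_of_le ?_)
    exact succ_le_iff_natCast_lt.2 (not_le.1 fun hle => not_le.2 h ((hτ_update s).1 hle))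
  · have hstopped (s : S) :
        stoppedProcess ψ τ (t + 1) (Function.update (fun k => X k ω) (t + 1) s) =
          stoppedProcess ψ τ t fun k => X k ω := by
      have hle := (hτ_update s).2 (not_lt.1 h)
      rw [← (hψ.stoppedProcess hτ).update_of_le le_rfl (fun k => X k ω) s]
      exact (stoppedProcess_eq_of_ge (hle.trans (Nat.cast_le.2 t.le_succ))).trans
        (stoppedProcess_eq_of_ge (i := t) hle).symm
    simp_rw [hstopped, ENNReal.tsum_mul_right, PMF.tsum_coe, one_mul]

omit hτ [Countable S] in
theorem lintegral_stoppedProcess_zero [IsProbabilityMeasure P] (hX : IsMarkovChain P K s₀ X)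
    {ψ : ℕ → (ℕ → S) → ℝ≥0∞} (hψ : IsNonanticipating ψ) :
    ∫⁻ ω, stoppedProcess ψ τ 0 (fun k => X k ω) ∂P = ψ 0 fun _ => s₀ := by
  have hae : ∀ᵐ ω ∂P, stoppedProcess ψ τ 0 (fun k => X k ω) = ψ 0 fun _ => s₀ := by
    filter_upwards [hX.ae_initial] with ω hω
    rw [stoppedProcess_eq_of_le bot_le]
    exact hψ 0 fun k hk => by rw [Nat.le_zero.1 hk, hω]
  rw [lintegral_congr_ae hae, lintegral_const, measure_univ, mul_one]

theorem lintegral_stoppedProcess_of_harmonic [IsProbabilityMeasure P]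
    (hX : IsMarkovChain P K s₀ X) {ψ : ℕ → (ℕ → S) → ℝ≥0∞} (hψ : IsNonanticipating ψ)
    (hstep : ∀ᵐ ω ∂P, ∀ t : ℕ, t < τ (fun k => X k ω) → ψ t (fun k => X k ω) =
      ∑' s, K (X t ω) s * ψ (t + 1) (Function.update (fun k => X k ω) (t + 1) s)) (t : ℕ) :
    ∫⁻ ω, stoppedProcess ψ τ t (fun k => X k ω) ∂P = ψ 0 fun _ => s₀ := by
  induction t with
  | zero => exact hX.lintegral_stoppedProcess_zero hψ
  | succ t ih =>
    rw [← ih, hX.lintegral_stoppedProcess_succ hτ hψ]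
    refine lintegral_congr_ae ?_
    filter_upwards [hstep] with ω hω
    split_ifs with h
    · exact (hω t h).symm.trans (stoppedProcess_eq_of_le (i := t) h.le).symm
    · rfl

/-- Optional stopping for the martingale of the conditional laws `L t` of the stopped value. -/
theorem map_stoppedValue_eq_toMeasure [IsProbabilityMeasure P] {β : Type*} [MeasurableSpace β]
    [Countable β] [MeasurableSingletonClass β] (hX : IsMarkovChain P K s₀ X)
    {L : ℕ → (ℕ → S) → PMF β} (hL : IsNonanticipating L) {f : ℕ → (ℕ → S) → β}
    (hf : IsNonanticipating f) (hfinite : ∀ᵐ ω ∂P, τ (fun k => X k ω) < ⊤)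
    (hstopped : ∀ᵐ ω ∂P, ∀ t : ℕ, τ (fun k => X k ω) = t →
      L t (fun k => X k ω) = PMF.pure (f t fun k => X k ω))
    (hstep : ∀ᵐ ω ∂P, ∀ t : ℕ, t < τ (fun k => X k ω) → L t (fun k => X k ω) =
      (K (X t ω)).bind fun s => L (t + 1) (Function.update (fun k => X k ω) (t + 1) s)) :
    P.map (stoppedValue (fun t ω => f t fun k => X k ω) fun ω => τ fun k => X k ω) =
      (L 0 fun _ => s₀).toMeasure := by
  set Y := stoppedValue (fun t ω => f t fun k => X k ω) fun ω => τ fun k => X k ω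
  have hYm : Measurable Y := hf.measurable_stoppedValue hτ hX.measurable
  refine Measure.ext_of_singleton fun b => ?_
  let ψ : ℕ → (ℕ → S) → ℝ≥0∞ := fun t x => L t x b
  have hψ : IsNonanticipating ψ := fun t x y hxy => congrArg (fun p : PMF β => p b) (hL t hxy)
  have hconst := hX.lintegral_stoppedProcess_of_harmonic hτ hψ (by
    filter_upwards [hstep] with ω hω t ht
    exact (congrArg (fun p : PMF β => p b) (hω t ht)).trans (PMF.bind_apply _ _ _))
  have hlim : ∀ᵐ ω ∂P, Filter.Tendsto (fun t => stoppedProcess ψ τ t fun k => X k ω) Filter.atTop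
      (nhds ((Y ⁻¹' {b}).indicator 1 ω)) := by
    filter_upwards [hfinite, hstopped] with ω hω hω'
    obtain ⟨s, hs⟩ := WithTop.ne_top_iff_exists.1 hω.ne
    have huntop : (τ fun k => X k ω).untopA = s := hs ▸ WithTop.untopD_coe _ s
    have hψτ : stoppedValue ψ τ (fun k => X k ω) = (Y ⁻¹' {b}).indicator 1 ω := by
      by_cases hb : b = f s fun k => X k ω <;>
        simp [Y, ψ, stoppedValue, huntop, hω' s hs.symm, hb, eq_comm]
    exact hψτ ▸ tendsto_stoppedProcess hω
  have hconv := tendsto_lintegral_of_dominated_convergence 1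
    (fun t => measurable_of_dependsOn hX.measurable (hψ.stoppedProcess hτ t))
    (fun t => ae_of_all P fun ω => PMF.coe_le_one _ _) (by simp) hlim
  simp only [hconst] at hconv
  rw [Measure.map_apply hYm (measurableSet_singleton b),
    PMF.toMeasure_apply_singleton _ _ (measurableSet_singleton b),
    ← lintegral_indicator_one (hYm (measurableSet_singleton b))]
  exact tendsto_nhds_unique hconv tendsto_const_nhds

theorem lintegral_stoppedProcess_succ_add_le (hX : IsMarkovChain P K s₀ X)
    {ψ : ℕ → (ℕ → S) → ℝ≥0∞} (hψ : IsNonanticipating ψ) {ε : ℝ≥0∞}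
    (hdrift : ∀ᵐ ω ∂P, ∀ t : ℕ, t < τ (fun k => X k ω) →
      (∑' s, K (X t ω) s * ψ (t + 1) (Function.update (fun k => X k ω) (t + 1) s)) + ε ≤
        ψ t fun k => X k ω) (t : ℕ) :
    ∫⁻ ω, stoppedProcess ψ τ (t + 1) (fun k => X k ω) ∂P +
        ε * P {ω | t < τ fun k => X k ω} ≤
      ∫⁻ ω, stoppedProcess ψ τ t (fun k => X k ω) ∂P := by
  have hτm : MeasurableSet {ω | t < τ fun k => X k ω} :=
    (pastFiltration X hX.measurable).le t _
      ((hτ.isStoppingTime hX.measurable).measurableSet_gt t)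
  rw [hX.lintegral_stoppedProcess_succ hτ hψ, ← lintegral_indicator_const hτm,
    ← lintegral_add_right _ (measurable_const.indicator hτm)]
  refine lintegral_mono_ae ?_
  filter_upwards [hdrift] with ω hω
  by_cases h : t < τ fun k => X k ω
  · simpa [h, stoppedProcess_eq_of_le (i := t) h.le] using hω t h
  · simp [h]

/-- The potential decreases on average by at least `ε` per step until `τ`, and it starts finite. -/
theorem ae_lt_top_of_drift [IsProbabilityMeasure P] (hX : IsMarkovChain P K s₀ X)
    {Z : ℕ → (ℕ → S) → ℕ} (hZ : IsNonanticipating Z) {ε : ℝ≥0∞} (hε : ε ≠ 0)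
    (hdrift : ∀ᵐ ω ∂P, ∀ t : ℕ, t < τ (fun k => X k ω) →
      (∑' s, K (X t ω) s * (Z (t + 1) (Function.update (fun k => X k ω) (t + 1) s) : ℝ≥0∞)) + ε ≤
        Z t fun k => X k ω) :
    ∀ᵐ ω ∂P, τ (fun k => X k ω) < ⊤ := by
  let ψ : ℕ → (ℕ → S) → ℝ≥0∞ := fun t x => Z t x
  have hψ : IsNonanticipating ψ := fun t x y hxy => congrArg Nat.cast (hZ t hxy)
  let p := P {ω | ¬ τ (fun k => X k ω) < ⊤}
  have hp_le (t : ℕ) : p ≤ P {ω | t < τ fun k => X k ω} :=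
    measure_mono fun ω hω => (WithTop.coe_lt_top t).trans_le (not_lt.1 hω)
  have hbound (t : ℕ) : t * (ε * p) + ∫⁻ ω, stoppedProcess ψ τ t (fun k => X k ω) ∂P ≤
      ψ 0 fun _ => s₀ := by
    induction t with
    | zero => simp [hX.lintegral_stoppedProcess_zero hψ]
    | succ t ih =>
      calc ((t + 1 : ℕ) : ℝ≥0∞) * (ε * p) +
            ∫⁻ ω, stoppedProcess ψ τ (t + 1) (fun k => X k ω) ∂P
          = t * (ε * p) + (∫⁻ ω, stoppedProcess ψ τ (t + 1) (fun k => X k ω) ∂P + ε * p) := by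
            push_cast; ring
        _ ≤ t * (ε * p) + ∫⁻ ω, stoppedProcess ψ τ t (fun k => X k ω) ∂P := by
            gcongr
            grw [hp_le t, hX.lintegral_stoppedProcess_succ_add_le hτ hψ hdrift t]
        _ ≤ ψ 0 fun _ => s₀ := ih
  have hzero : ε * p = 0 := by
    by_contra hne
    obtain ⟨t, ht⟩ := ENNReal.exists_nat_mul_gt hne (ENNReal.natCast_ne_top (Z 0 fun _ => s₀))
    exact (le_self_add.trans (hbound t)).not_gt ht
  exact (mul_eq_zero.1 hzero).resolve_left hε

end Stopping

end IsMarkovChain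

theorem tsum_mul_add_le_of_exists {S : Type*} (p : PMF S) {φ : S → ℕ} {N : ℕ} {ε : ℝ≥0∞}
    (hle : ∀ s, p s ≠ 0 → φ s ≤ N) (hlt : ∃ s, ε ≤ p s ∧ φ s < N) :
    ∑' s, p s * (φ s : ℝ≥0∞) + ε ≤ N := by
  classical
  obtain ⟨s₁, hε, hs₁⟩ := hlt
  have hind : ε ≤ ∑' s, p s * (if s = s₁ then 1 else 0) := by simpa using hε
  calc ∑' s, p s * (φ s : ℝ≥0∞) + ε
      ≤ ∑' s, p s * (φ s : ℝ≥0∞) + ∑' s, p s * (if s = s₁ then 1 else 0) := by gcongr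
    _ = ∑' s, p s * ((φ s + if s = s₁ then 1 else 0 : ℕ) : ℝ≥0∞) := by
        rw [← ENNReal.tsum_add]
        exact tsum_congr fun s => by push_cast; rw [mul_add]
    _ ≤ ∑' s, p s * N := by
        refine ENNReal.tsum_le_tsum fun s => ?_
        rcases eq_or_ne (p s) 0 with hps | hps
        · simp [hps]
        · gcongr
          split_ifs with hs
          · exact hs ▸ hs₁
          · exact hle s hps
    _ = N := by rw [ENNReal.tsum_mul_right, PMF.tsum_coe, one_mul]

theorem card_mul_uniformOfFinset_bind_apply {α β : Type*} {s : Finset α} (hs : s.Nonempty)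
    (f : α → PMF β) (b : β) :
    (s.card : ℝ≥0∞) * (PMF.uniformOfFinset s hs).bind f b = ∑ a ∈ s, f a b := by
  have hne : (s.card : ℝ≥0∞) ≠ 0 := by simpa using hs.ne_empty
  rw [PMF.bind_apply, tsum_eq_sum (s := s) fun a ha => by
    rw [PMF.uniformOfFinset_apply_of_notMem hs ha, zero_mul], Finset.mul_sum]
  refine Finset.sum_congr rfl fun a ha => ?_
  rw [PMF.uniformOfFinset_apply_of_mem hs ha,
    ENNReal.mul_inv_cancel_left hne (ENNReal.natCast_ne_top _)]

theorem map_cons_apply_cons {α : Type*} [DecidableEq α] (p : PMF (List α)) (x v : α)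
    (l : List α) : p.map (x :: ·) (v :: l) = if x = v then p l else 0 := by
  rw [PMF.map_apply]
  split_ifs with h
  · subst h
    rw [tsum_eq_single l fun l' hl' => by simp [hl'.symm]]
    simp
  · simp [Ne.symm h]

theorem map_cons_apply_nil {α : Type*} (p : PMF (List α)) (x : α) : p.map (x :: ·) [] = 0 := by
  simp [PMF.map_apply]

theorem uniformOfFinset_insert_bind {α β : Type*} [DecidableEq α] {A : Finset α} {a : α}
    (ha : a ∉ A) (hA : A.Nonempty) {f g : α → PMF β} (hfg : ∀ x ∈ A, g x = f x)
    (hga : g a = (PMF.uniformOfFinset A hA).bind f) :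
    (PMF.uniformOfFinset (insert a A) (Finset.insert_nonempty a A)).bind g =
      (PMF.uniformOfFinset A hA).bind f := by
  ext b
  rw [← ENNReal.mul_right_inj (a := ((insert a A).card : ℝ≥0∞)) (by simp)
    (ENNReal.natCast_ne_top _), card_mul_uniformOfFinset_bind_apply, Finset.sum_insert ha, hga,
    Finset.sum_congr rfl fun x hx => congrArg (fun p : PMF β => p b) (hfg x hx),
    ← card_mul_uniformOfFinset_bind_apply hA, Finset.card_insert_of_notMem ha]
  push_cast
  ring

section Uniform

variable {V β : Type*} [Fintype V]

theorem LoopGraph.complete_step_eq_uniformOfFintype [Nonempty V] (v : V) :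
    (LoopGraph.complete V).step v = PMF.uniformOfFintype V := by
  have hnbrs : (LoopGraph.complete V).nbrs v = Finset.univ := by
    classical exact Finset.filter_true_of_mem fun _ _ => trivial
  rw [LoopGraph.step, dif_pos (hnbrs ▸ Finset.univ_nonempty)]
  simp only [hnbrs, PMF.uniformOfFintype]

variable [Nonempty V]

theorem card_mul_uniformOfFintype_bind_apply (f : V → PMF β) (b : β) :
    (Fintype.card V : ℝ≥0∞) * (PMF.uniformOfFintype V).bind f b = ∑ a, f a b :=
  card_mul_uniformOfFinset_bind_apply Finset.univ_nonempty f b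

variable (V) in
theorem eq_of_card_mul_apply_eq {p q : PMF β}
    (h : ∀ b, (Fintype.card V : ℝ≥0∞) * p b = Fintype.card V * q b) : p = q :=
  PMF.ext fun b => (ENNReal.mul_right_inj (by simp) (ENNReal.natCast_ne_top _)).1 (h b)

variable [DecidableEq V]

theorem card_mul_uniformOfFintype_bind_ite_apply (A : Finset V) (f g : V → PMF β) (b : β) :
    (Fintype.card V : ℝ≥0∞) *
        ((PMF.uniformOfFintype V).bind fun x => if x ∈ A then f x else g x) b =
      ∑ x ∈ A, f x b + ∑ x ∈ Aᶜ, g x b := by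
  rw [card_mul_uniformOfFintype_bind_apply, ← Finset.sum_add_sum_compl A]
  congr 1
  · exact Finset.sum_congr rfl fun x hx => by rw [if_pos hx]
  · exact Finset.sum_congr rfl fun x hx => by rw [if_neg (Finset.mem_compl.1 hx)]

theorem uniformOfFintype_bind_ite_congr {A : Finset V} (hA : A.Nonempty) {f f' : V → PMF β}
    (h : (PMF.uniformOfFinset A hA).bind f = (PMF.uniformOfFinset A hA).bind f') (g : V → PMF β) :
    ((PMF.uniformOfFintype V).bind fun x => if x ∈ A then f x else g x) =
      (PMF.uniformOfFintype V).bind fun x => if x ∈ A then f' x else g x :=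
  eq_of_card_mul_apply_eq V fun b => by
    simp only [card_mul_uniformOfFintype_bind_ite_apply,
      ← card_mul_uniformOfFinset_bind_apply hA, h]

theorem uniformOfFinset_bind_uniformOfFintype_bind_ite {A : Finset V} (hA : A.Nonempty)
    (f : V → PMF β) (g : V → V → PMF β) :
    ((PMF.uniformOfFinset A hA).bind fun z =>
        (PMF.uniformOfFintype V).bind fun x => if x ∈ A then f z else g x z) =
      (PMF.uniformOfFintype V).bind fun x =>
        if x ∈ A then f x else (PMF.uniformOfFinset A hA).bind (g x) := by
  rw [PMF.bind_comm, ← uniformOfFintype_bind_ite_congr hA (PMF.bind_const _ _)]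
  exact congrArg _ (funext fun x => by split_ifs <;> rfl)

end Uniform

section FreshRun

variable {V : Type*} [Fintype V] [DecidableEq V] [Nonempty V]

/-- The law of the sequence of vertices outside `A` that are met by a sequence of independent
uniformly chosen vertices before it first meets a vertex of `A` or repeats itself. -/
def freshRun (A : Finset V) : PMF (List V) :=
  (PMF.uniformOfFintype V).bind fun x =>
    if _ : x ∈ A then PMF.pure [] else (freshRun (insert x A)).map (x :: ·)
termination_by Aᶜ.card
decreasing_by exact Finset.card_lt_card (by simpa [Finset.ssubset_iff] using ⟨x, by simp_all⟩)

/-- The law of a fresh run conditioned not to be empty: its first vertex is uniform on `Aᶜ`. -/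
def freshBranch (A : Finset V) (hA : Aᶜ.Nonempty) : PMF (List V) :=
  (PMF.uniformOfFinset Aᶜ hA).bind fun v => (freshRun (insert v A)).map (v :: ·)

theorem freshRun_bind {β : Type*} (A : Finset V) (g : List V → PMF β) :
    (freshRun A).bind g = (PMF.uniformOfFintype V).bind fun x =>
      if x ∈ A then g [] else (freshRun (insert x A)).bind fun l => g (x :: l) := by
  rw [freshRun, PMF.bind_bind]
  congr with x : 1
  split_ifs
  · exact PMF.pure_bind _ _
  · exact PMF.bind_map _ _ _

theorem card_mul_freshRun_bind_apply {β : Type*} (A : Finset V) (g : List V → PMF β) (b : β) :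
    (Fintype.card V : ℝ≥0∞) * (freshRun A).bind g b =
      A.card * g [] b + ∑ x ∈ Aᶜ, ((freshRun (insert x A)).bind fun l => g (x :: l)) b := by
  rw [freshRun_bind, card_mul_uniformOfFintype_bind_ite_apply, Finset.sum_const, nsmul_eq_mul]

theorem freshRun_univ : freshRun (Finset.univ : Finset V) = PMF.pure [] := by
  rw [freshRun]
  simp

theorem card_mul_freshBranch_bind_apply {β : Type*} (A : Finset V) (hA : Aᶜ.Nonempty)
    (g : List V → PMF β) (b : β) :
    (Aᶜ.card : ℝ≥0∞) * (freshBranch A hA).bind g b =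
      ∑ x ∈ Aᶜ, ((freshRun (insert x A)).bind fun l => g (x :: l)) b := by
  rw [freshBranch, PMF.bind_bind, card_mul_uniformOfFinset_bind_apply]
  simp only [PMF.bind_map, Function.comp_def]

theorem freshRun_bind_eq_bind_freshBranch {β : Type*} (A : Finset V) (hA : Aᶜ.Nonempty)
    (g : List V → PMF β) :
    (freshRun A).bind g = (PMF.uniformOfFintype V).bind fun x =>
      if x ∈ A then g [] else (freshBranch A hA).bind g :=
  eq_of_card_mul_apply_eq V fun b => by
    rw [card_mul_freshRun_bind_apply, card_mul_uniformOfFintype_bind_ite_apply, Finset.sum_const,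
      Finset.sum_const, nsmul_eq_mul, nsmul_eq_mul, card_mul_freshBranch_bind_apply]

theorem freshBranch_bind_congr {β : Type*} {A : Finset V} (hA : Aᶜ.Nonempty)
    {f g : List V → PMF β} (h : ∀ l, l ≠ [] → f l = g l) :
    (freshBranch A hA).bind f = (freshBranch A hA).bind g := by
  simp only [freshBranch, PMF.bind_bind, PMF.bind_map, Function.comp_def,
    h _ (List.cons_ne_nil _ _)]

theorem card_mul_freshRun_apply_nil (A : Finset V) :
    (Fintype.card V : ℝ≥0∞) * freshRun A [] = A.card := by
  have h := card_mul_freshRun_bind_apply A PMF.pure []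
  have hnil (x : V) : ((freshRun (insert x A)).bind fun l => PMF.pure (x :: l)) [] = 0 :=
    map_cons_apply_nil _ _
  simpa [hnil] using h

theorem card_mul_freshRun_apply_cons (A : Finset V) (v : V) (l : List V) :
    (Fintype.card V : ℝ≥0∞) * freshRun A (v :: l) =
      if v ∈ A then 0 else freshRun (insert v A) l := by
  have h := card_mul_freshRun_bind_apply A PMF.pure (v :: l)
  simp only [PMF.bind_pure, PMF.pure_apply, reduceCtorEq, if_false, mul_zero, zero_add] at h
  rw [h]
  have (x : V) : ((freshRun (insert x A)).bind fun l' => PMF.pure (x :: l')) (v :: l) =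
      if x = v then freshRun (insert x A) l else 0 := map_cons_apply_cons _ _ _ _
  simp only [this, Finset.sum_ite_eq', Finset.mem_compl, ite_not]

theorem freshRun_apply (A : Finset V) (l : List V) :
    freshRun A l = if l.Nodup ∧ ∀ x ∈ l, x ∉ A
      then ((A.card + l.length : ℕ) : ℝ≥0∞) / Fintype.card V ^ (l.length + 1) else 0 := by
  have hn : (Fintype.card V : ℝ≥0∞) ≠ 0 := by simp
  have hn' : (Fintype.card V : ℝ≥0∞) ≠ ⊤ := ENNReal.natCast_ne_top _
  induction l generalizing A with
  | nil => simpa using (ENNReal.eq_div_iff hn hn').2 (card_mul_freshRun_apply_nil A)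
  | cons v l ih =>
    have h := card_mul_freshRun_apply_cons A v l
    rw [ih] at h
    rw [← ENNReal.mul_right_inj hn hn', h]
    by_cases hv : v ∈ A
    · simp [hv]
    · have hiff : ((v :: l).Nodup ∧ ∀ x ∈ v :: l, x ∉ A) ↔
          l.Nodup ∧ ∀ x ∈ l, x ∉ insert v A := by
        simp only [List.nodup_cons, List.forall_mem_cons, Finset.mem_insert]
        grind
      rw [if_neg hv, Finset.card_insert_of_notMem hv, List.length_cons, mul_ite, mul_zero]
      simp only [hiff]
      congr 1
      rw [pow_succ' _ (l.length + 1), div_eq_mul_inv, div_eq_mul_inv,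
        ENNReal.mul_inv (.inl hn) (.inl hn'), mul_left_comm,
        ENNReal.mul_inv_cancel_left hn hn', add_right_comm, add_assoc]

theorem card_mul_freshBranch_apply (A : Finset V) (hA : Aᶜ.Nonempty) (p : List V) :
    (Aᶜ.card : ℝ≥0∞) * freshBranch A hA p =
      if p = [] then 0 else Fintype.card V * freshRun A p := by
  rw [freshBranch, card_mul_uniformOfFinset_bind_apply]
  cases p with
  | nil => simp
  | cons v l =>
    simp only [map_cons_apply_cons, Finset.sum_ite_eq', Finset.mem_compl, ite_not,
      card_mul_freshRun_apply_cons, reduceCtorEq, if_false]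

theorem freshBranch_map_reverse (A : Finset V) (hA : Aᶜ.Nonempty) :
    (freshBranch A hA).map List.reverse = freshBranch A hA := by
  ext p
  rw [PMF.map_apply, tsum_eq_single p.reverse fun q hq => by simp; grind]
  have hc : (Aᶜ.card : ℝ≥0∞) ≠ 0 := by simpa using hA.ne_empty
  rw [if_pos p.reverse_reverse.symm, ← ENNReal.mul_right_inj hc (ENNReal.natCast_ne_top _),
    card_mul_freshBranch_apply, card_mul_freshBranch_apply]
  simp [freshRun_apply]

end FreshRun

/-- The tree `T` with the additional vertex `x` and the additional edge `{u, x}`. -/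
def PartialTree.grow {V : Type*} [DecidableEq V] (T : PartialTree V) (u x : V) : PartialTree V where
  verts := insert x T.verts
  edges := insert s(u, x) T.edges

namespace Wilson

section AddPath

variable {V : Type*}

theorem zipWith_append_pair (q : List V) (v u : V) :
    List.zipWith (fun a b => s(a, b)) (q ++ [v, u]) (q ++ [v, u]).tail =
      List.zipWith (fun a b => s(a, b)) (q ++ [v]) (q ++ [v]).tail ++ [s(v, u)] := by
  induction q with
  | nil => simp
  | cons a q ih =>
    rcases q with _ | ⟨b, q⟩
    · simp
    · simpa using ih

theorem zipWith_reverse (p : List V) :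
    List.zipWith (fun a b => s(a, b)) p.reverse p.reverse.tail =
      (List.zipWith (fun a b => s(a, b)) p p.tail).reverse := by
  induction p with
  | nil => rfl
  | cons a p ih =>
    rcases p with _ | ⟨b, p⟩
    · rfl
    · rw [List.reverse_cons, List.reverse_cons, List.append_assoc, List.singleton_append,
        zipWith_append_pair, ← List.reverse_cons, ih]
      simp [Sym2.eq_swap]

variable [DecidableEq V]

theorem addPath_cons_cons (T : PartialTree V) {u : V} (hu : u ∈ T.verts) (v : V) (q : List V) :
    addPath T (u :: v :: q) = addPath (T.grow u v) (v :: q) := by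
  ext y
  · simp only [addPath, PartialTree.grow, Finset.mem_union, List.mem_toFinset, List.mem_cons,
      Finset.mem_insert]
    grind
  · simp only [addPath, PartialTree.grow, Finset.mem_union, List.mem_toFinset, List.tail_cons,
      List.zipWith_cons_cons, List.mem_cons, Finset.mem_insert]
    tauto

theorem addPath_singleton (T : PartialTree V) {u : V} (hu : u ∈ T.verts) : addPath T [u] = T := by
  ext y
  · simp only [addPath, Finset.mem_union, List.mem_toFinset, List.mem_singleton]
    grind
  · simp [addPath]

theorem addPath_reverse (T : PartialTree V) (p : List V) : addPath T p.reverse = addPath T p := by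
  rw [addPath, zipWith_reverse, List.toFinset_reverse, List.toFinset_reverse, addPath]

end AddPath

end Wilson

section BranchLaw

variable {V : Type*} [Fintype V] [DecidableEq V] [Nonempty V] {T : PartialTree V}

/-- The law of the tree `T` after the addition of one more branch, which leaves `T` at a uniformly
chosen vertex and then makes a nonempty fresh run. A spanning tree receives no further branch. -/
def branchLaw (T : PartialTree V) : PMF (PartialTree V) :=
  if h : T.verts.Nonempty ∧ T.vertsᶜ.Nonempty then
    (PMF.uniformOfFinset T.verts h.1).bind fun u =>
      (freshBranch T.verts h.2).map fun p => Wilson.addPath T (u :: p)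
  else PMF.pure T

/-- The law of the tree `T` after the addition of `k` more branches. -/
def branchesLaw : ℕ → PartialTree V → PMF (PartialTree V)
  | 0, T => PMF.pure T
  | k + 1, T => (branchLaw T).bind (branchesLaw k)

/-- The law of the tree `T` after the completion of a branch that has reached the vertex `x`, and
the addition of `k` more branches. -/
def growingLaw (k : ℕ) (T : PartialTree V) (x : V) : PMF (PartialTree V) :=
  (freshRun T.verts).bind fun l => branchesLaw k (Wilson.addPath T (x :: l))

/-- The law of the tree `T` after the addition of `k` more branches, given that the walk is at the
vertex `x` of `T`: the first branch leaves `T` at `x` if the walk leaves `T` in its next step, and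
at a uniformly chosen vertex otherwise. -/
def idleLaw : ℕ → PartialTree V → V → PMF (PartialTree V)
  | 0, T, _ => PMF.pure T
  | k + 1, T, x => (freshRun T.verts).bind fun l =>
      if l = [] then branchesLaw (k + 1) T else branchesLaw k (Wilson.addPath T (x :: l))

theorem branchesLaw_of_verts_eq_univ (hT : T.verts = Finset.univ) (k : ℕ) :
    branchesLaw k T = PMF.pure T := by
  induction k with
  | zero => rfl
  | succ k ih => rw [branchesLaw, branchLaw, dif_neg (by simp [hT]), PMF.pure_bind, ih]

theorem growingLaw_of_verts_eq_univ (hT : T.verts = Finset.univ) (k : ℕ) (x : V) :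
    growingLaw k T x = PMF.pure T := by
  rw [growingLaw, hT, freshRun_univ, PMF.pure_bind, Wilson.addPath_singleton T (by simp [hT]),
    branchesLaw_of_verts_eq_univ hT]

theorem idleLaw_of_verts_eq_univ (hT : T.verts = Finset.univ) (k : ℕ) (x : V) :
    idleLaw k T x = PMF.pure T := by
  cases k with
  | zero => rfl
  | succ k => rw [idleLaw, hT, freshRun_univ, PMF.pure_bind, if_pos rfl,
      branchesLaw_of_verts_eq_univ hT]

theorem uniformOfFinset_bind_idleLaw (hT : T.verts.Nonempty) (k : ℕ) :
    (PMF.uniformOfFinset T.verts hT).bind (idleLaw k T) = branchesLaw k T := by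
  cases k with
  | zero => exact PMF.bind_const _ _
  | succ k =>
    rcases Finset.eq_empty_or_nonempty T.vertsᶜ with hTc | hTc
    · have hspan := Finset.compl_eq_empty_iff _ |>.1 hTc
      rw [funext (idleLaw_of_verts_eq_univ hspan (k + 1)), PMF.bind_const,
        branchesLaw_of_verts_eq_univ hspan]
    · have hbranch : branchesLaw (k + 1) T = (PMF.uniformOfFinset T.verts hT).bind fun u =>
          (freshBranch T.verts hTc).bind fun l =>
            if l = [] then branchesLaw (k + 1) T
            else branchesLaw k (Wilson.addPath T (u :: l)) := by
        rw [branchesLaw, branchLaw, dif_pos ⟨hT, hTc⟩, PMF.bind_bind]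
        simp only [PMF.bind_map]
        exact congrArg _ (funext fun u => freshBranch_bind_congr hTc fun l hl => (if_neg hl).symm)
      have hidle : idleLaw (k + 1) T = fun u => (PMF.uniformOfFintype V).bind fun x =>
          if x ∈ T.verts then branchesLaw (k + 1) T else (freshBranch T.verts hTc).bind fun l =>
            if l = [] then branchesLaw (k + 1) T
            else branchesLaw k (Wilson.addPath T (u :: l)) :=
        funext fun u => freshRun_bind_eq_bind_freshBranch _ hTc _
      rw [hidle, PMF.bind_comm]
      refine (congrArg _ (funext fun x => ?_)).trans (PMF.bind_const (PMF.uniformOfFintype V) _)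
      split_ifs
      · exact PMF.bind_const _ _
      · exact hbranch.symm

theorem growingLaw_eq_bind (k : ℕ) {x : V} (hx : x ∈ T.verts) :
    growingLaw k T x = (PMF.uniformOfFintype V).bind fun s =>
      if s ∈ T.verts then idleLaw k T s else growingLaw k (T.grow x s) s := by
  have hT : T.verts.Nonempty := ⟨x, hx⟩
  have hidle : (PMF.uniformOfFinset T.verts hT).bind (idleLaw k T) =
      (PMF.uniformOfFinset T.verts hT).bind fun _ => branchesLaw k T := by
    rw [uniformOfFinset_bind_idleLaw, PMF.bind_const]
  rw [uniformOfFintype_bind_ite_congr hT hidle, growingLaw, freshRun_bind]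
  simp only [Wilson.addPath_singleton T hx, Wilson.addPath_cons_cons T hx]
  rfl

theorem idleLaw_succ_eq_bind (k : ℕ) {x : V} (hx : x ∈ T.verts) :
    idleLaw (k + 1) T x = (PMF.uniformOfFintype V).bind fun s =>
      if s ∈ T.verts then idleLaw (k + 1) T s else growingLaw k (T.grow x s) s := by
  have hT : T.verts.Nonempty := ⟨x, hx⟩
  have hidle : (PMF.uniformOfFinset T.verts hT).bind (idleLaw (k + 1) T) =
      (PMF.uniformOfFinset T.verts hT).bind fun _ => branchesLaw (k + 1) T := by
    rw [uniformOfFinset_bind_idleLaw, PMF.bind_const]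
  rw [uniformOfFintype_bind_ite_congr hT hidle, idleLaw, freshRun_bind]
  simp only [Wilson.addPath_cons_cons T hx, reduceCtorEq, if_false, if_true]
  rfl

end BranchLaw

namespace Wilson

section LoopStep

variable {V : Type*} [DecidableEq V]

/-- The loop erasure of a walk after a further step to `x`, if its loop erasure before that step
is `q`. -/
def loopStep (q : List V) (x : V) : List V :=
  q.takeWhile (fun y => decide (y ≠ x)) ++ [x]

theorem loopErase_append (w : List V) (x : V) :
    loopErase (w ++ [x]) = loopStep (loopErase w) x := by
  simp [loopErase, loopStep, List.foldl_append]

theorem loopStep_of_notMem {q : List V} {x : V} (hx : x ∉ q) : loopStep q x = q ++ [x] := by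
  rw [loopStep, List.takeWhile_eq_self_iff.2]
  grind

theorem loopStep_append_cons {p : List V} {x : V} (hx : x ∉ p) (l : List V) :
    loopStep (p ++ x :: l) x = p ++ [x] := by
  rw [loopStep, List.takeWhile_append_of_pos (by grind),
    List.takeWhile_cons_of_neg (by simp), List.append_nil]

theorem loopStep_append_of_mem {q : List V} {x : V} (hx : x ∈ q) (l : List V) :
    loopStep (q ++ l) x = loopStep q x := by
  obtain ⟨p, b, rfl, hp⟩ := List.eq_append_cons_of_mem hx
  rw [List.append_assoc, List.cons_append, loopStep_append_cons hp, loopStep_append_cons hp]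

theorem length_loopStep_le {q : List V} {x : V} (hx : x ∈ q) :
    (loopStep q x).length ≤ q.length := by
  obtain ⟨p, b, rfl, hp⟩ := List.eq_append_cons_of_mem hx
  simp [loopStep_append_cons hp]

theorem nodup_loopStep {q : List V} (hq : q.Nodup) (x : V) : (loopStep q x).Nodup := by
  rw [loopStep, List.nodup_append]
  refine ⟨hq.sublist (List.takeWhile_sublist _), List.nodup_singleton x, fun a ha b hb => ?_⟩
  rw [List.mem_singleton.1 hb]
  simpa using List.mem_takeWhile_imp ha

theorem mem_or_eq_of_mem_loopStep {q : List V} {x y : V} (hy : y ∈ loopStep q x) :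
    y ∈ q ∨ y = x :=
  (List.mem_append.1 hy).imp (fun h => (List.takeWhile_sublist _).subset h) List.mem_singleton.1

theorem loopStep_ne_nil (q : List V) (x : V) : loopStep q x ≠ [] := by
  simp [loopStep]

end LoopStep

section WalkLaw

variable {V : Type*} [Fintype V] [DecidableEq V] [Nonempty V] {T : PartialTree V}

/-- The law of the tree `T` after the addition of the branch in progress, if `q` is the loop
erasure of the walk under way. The branch is sampled backwards: `z` is the vertex from which the
walk moves for the last time off the path that precedes the last vertex of `q`. -/
def walkLaw (T : PartialTree V) (hT : T.verts.Nonempty) (q : List V) : PMF (PartialTree V) :=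
  (PMF.uniformOfFinset (T.verts ∪ q.dropLast.toFinset) (hT.mono Finset.subset_union_left)).bind
    fun z => if _ : z ∈ q.dropLast then walkLaw T hT (loopStep q.dropLast z)
      else (freshRun (T.verts ∪ q.toFinset)).map fun l => addPath T (q ++ l ++ [z])
termination_by q.length
decreasing_by
  have := length_loopStep_le ‹_›
  have := List.length_pos_of_mem ‹_›
  grind

theorem walkLaw_append_singleton (hT : T.verts.Nonempty) (q : List V) (x : V) :
    walkLaw T hT (q ++ [x]) = (PMF.uniformOfFinset (T.verts ∪ q.toFinset)
      (hT.mono Finset.subset_union_left)).bind fun z =>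
        if z ∈ q then walkLaw T hT (loopStep q z)
        else (freshRun (insert x (T.verts ∪ q.toFinset))).map fun l =>
          addPath T (q ++ x :: l ++ [z]) := by
  have hinsert : T.verts ∪ (q ++ [x]).toFinset = insert x (T.verts ∪ q.toFinset) := by
    ext; simp
  rw [walkLaw]
  simp only [List.dropLast_concat, dite_eq_ite, hinsert, List.append_assoc, List.cons_append,
    List.nil_append]

theorem walkLaw_eq_bind_union (hT : T.verts.Nonempty) {q : List V} (hne : q ≠ [])
    (hnodup : q.Nodup) (hdisj : ∀ x ∈ q, x ∉ T.verts) :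
    walkLaw T hT q = (PMF.uniformOfFinset (T.verts ∪ q.toFinset)
      (hT.mono Finset.subset_union_left)).bind fun z =>
        if z ∈ q then walkLaw T hT (loopStep q z)
        else (freshRun (T.verts ∪ q.toFinset)).map fun l => addPath T (q ++ l ++ [z]) := by
  obtain ⟨p, v, rfl⟩ : ∃ p v, q = p ++ [v] := ⟨_, _, (List.dropLast_concat_getLast hne).symm⟩
  have hvp : v ∉ p := by grind
  have hv : v ∉ T.verts ∪ p.toFinset := by simp_all
  have hinsert : T.verts ∪ (p ++ [v]).toFinset = insert v (T.verts ∪ p.toFinset) := by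
    ext; simp
  simp only [walkLaw_append_singleton, hinsert]
  refine (uniformOfFinset_insert_bind hv (hT.mono Finset.subset_union_left)
    (fun z hz => ?_) ?_).symm
  · have hzv : z ≠ v := fun h => hv (h ▸ hz)
    by_cases hzp : z ∈ p
    · rw [if_pos hzp, if_pos (List.mem_append_left _ hzp), loopStep_append_of_mem hzp]
    · rw [if_neg hzp, if_neg (by simp [hzp, hzv])]
      simp only [List.append_assoc, List.cons_append, List.nil_append]
  · rw [if_pos (by simp), loopStep_append_cons hvp, walkLaw_append_singleton]

theorem walkLaw_eq_bind (hT : T.verts.Nonempty) {q : List V} (hne : q ≠ [])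
    (hnodup : q.Nodup) (hdisj : ∀ x ∈ q, x ∉ T.verts) :
    walkLaw T hT q = (PMF.uniformOfFintype V).bind fun x =>
      if x ∈ T.verts then PMF.pure (addPath T (loopStep q x)) else walkLaw T hT (loopStep q x) := by
  let B := T.verts ∪ q.toFinset
  have hB : B.Nonempty := hT.mono Finset.subset_union_left
  let inside (z : V) : PMF (PartialTree V) :=
    if z ∈ q then walkLaw T hT (loopStep q z) else PMF.pure (addPath T (q ++ [z]))
  let outside (x z : V) : PMF (PartialTree V) :=
    if z ∈ q then walkLaw T hT (loopStep q z)
    else (freshRun (insert x B)).map fun l => addPath T (q ++ x :: l ++ [z])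
  calc walkLaw T hT q
      = (PMF.uniformOfFinset B hB).bind fun z =>
          (PMF.uniformOfFintype V).bind fun x => if x ∈ B then inside z else outside x z := by
        rw [walkLaw_eq_bind_union hT hne hnodup hdisj]
        refine congrArg _ (funext fun z => ?_)
        by_cases hz : z ∈ q
        · simp only [inside, outside, if_pos hz, ite_self, PMF.bind_const]
        · rw [if_neg hz, PMF.map, freshRun_bind]
          simp only [inside, outside, if_neg hz, Function.comp_apply, List.append_nil]
          rfl
    _ = (PMF.uniformOfFintype V).bind fun x => if x ∈ B then inside x
          else (PMF.uniformOfFinset B hB).bind (outside x) :=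
        uniformOfFinset_bind_uniformOfFintype_bind_ite hB inside outside
    _ = (PMF.uniformOfFintype V).bind fun x => if x ∈ T.verts
          then PMF.pure (addPath T (loopStep q x)) else walkLaw T hT (loopStep q x) := by
        refine congrArg _ (funext fun x => ?_)
        by_cases hx : x ∈ B
        · rw [if_pos hx]
          by_cases hxq : x ∈ q
          · rw [if_neg (hdisj x hxq)]
            exact if_pos hxq
          · rw [if_pos ((Finset.mem_union.1 hx).resolve_right (by simpa using hxq)),
              loopStep_of_notMem hxq]
            exact if_neg hxq
        · have hxq : x ∉ q := fun h => hx (Finset.mem_union_right _ (List.mem_toFinset.2 h))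
          rw [if_neg hx, if_neg fun h => hx (Finset.mem_union_left _ h), loopStep_of_notMem hxq,
            walkLaw_append_singleton]

theorem uniformOfFinset_bind_walkLaw (hT : T.verts.Nonempty) (hTc : T.vertsᶜ.Nonempty) :
    ((PMF.uniformOfFinset T.vertsᶜ hTc).bind fun v => walkLaw T hT [v]) = branchLaw T := by
  have hreverse (z : V) : ((freshBranch T.verts hTc).map fun p => addPath T (p ++ [z])) =
      (freshBranch T.verts hTc).map fun p => addPath T (z :: p) := by
    conv_rhs => rw [← freshBranch_map_reverse]
    rw [PMF.map_comp]
    congr 1 with p : 1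
    rw [Function.comp_apply, ← addPath_reverse, List.reverse_append, List.reverse_singleton,
      List.singleton_append]
  have hwalk (v : V) : walkLaw T hT [v] = (PMF.uniformOfFinset T.verts hT).bind fun z =>
      (freshRun (insert v T.verts)).map fun l => addPath T (v :: l ++ [z]) := by
    rw [walkLaw]
    simp [Finset.union_comm T.verts {v}]
  rw [branchLaw, dif_pos ⟨hT, hTc⟩, funext hwalk, PMF.bind_comm]
  refine congrArg _ (funext fun z => ?_)
  rw [← hreverse z, freshBranch, PMF.map_bind]
  simp only [PMF.map_comp]
  rfl

end WalkLaw

end Wilson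

section RandomTime

theorem lt_natCast_succ_iff {a : WithTop ℕ} {t : ℕ} : a < ((t + 1 : ℕ) : WithTop ℕ) ↔ a ≤ t :=
  not_le.symm.trans ((not_congr succ_le_iff_natCast_lt).trans not_lt)

theorem firstTime_le_iff {p : ℕ → Prop} {t : ℕ} : firstTime p ≤ t ↔ ∃ s ≤ t, p s := by
  constructor
  · intro h
    by_contra! hne
    have : ((t + 1 : ℕ) : WithTop ℕ) ≤ firstTime p :=
      le_iInf₂ fun s hs => Nat.cast_le.2 (not_le.1 fun hst => hne s hst hs)
    exact (succ_le_iff_natCast_lt.1 this).not_ge h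
  · rintro ⟨s, hst, hs⟩
    exact (iInf₂_le s hs).trans (Nat.cast_le.2 hst)

theorem prop_of_firstTime_eq {p : ℕ → Prop} {t : ℕ} (h : firstTime p = t) : p t := by
  obtain ⟨s, hst, hs⟩ := firstTime_le_iff.1 h.le
  have hts : t ≤ s := Nat.cast_le.1 (h.symm.le.trans (firstTime_le_iff.2 ⟨s, le_rfl, hs⟩))
  rwa [hts.antisymm hst]

theorem lt_count_iff_exists (q : ℕ → Prop) [DecidablePred q] {i t : ℕ} :
    i < Nat.count q t ↔ ∃ s < t, i ≤ Nat.count q s ∧ q s := by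
  induction t with
  | zero => simp
  | succ t ih =>
    rw [Nat.count_succ]
    simp only [Nat.lt_succ_iff_lt_or_eq, or_and_right, exists_or, ← ih, exists_eq_left]
    split_ifs with h <;> grind

theorem le_natCast_iff_of_succ_eq_firstTime {σ : ℕ → WithTop ℕ} {e : WithTop ℕ} {p : ℕ → Prop}
    [DecidablePred p] (hzero : σ 0 = 0)
    (hsucc : ∀ i, σ (i + 1) = firstTime (fun t => σ i < t ∧ p t) ⊓ e) (i t : ℕ) :
    σ i ≤ t ↔ e ≤ t ∨ i ≤ Nat.count (fun s => p (s + 1)) t := by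
  induction i generalizing t with
  | zero => simp [hzero]
  | succ i ih =>
    rw [hsucc, inf_le_iff, or_comm, firstTime_le_iff, Nat.succ_le_iff, lt_count_iff_exists]
    refine or_congr_right' fun he => ⟨?_, ?_⟩
    · rintro ⟨s, hst, hs, hp⟩
      obtain ⟨s, rfl⟩ := Nat.exists_eq_succ_of_ne_zero (n := s) (by rintro rfl; simp at hs)
      refine ⟨s, hst, ((ih s).1 (lt_natCast_succ_iff.1 hs)).resolve_left fun h => ?_, hp⟩
      exact he (h.trans (Nat.cast_le.2 (Nat.le_of_lt hst)))
    · rintro ⟨s, hst, hs, hp⟩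
      exact ⟨s + 1, hst, lt_natCast_succ_iff.2 ((ih s).2 (.inr hs)), hp⟩

theorem eq_or_le_of_eq_natCast {σ e : WithTop ℕ} {p : ℕ → Prop}
    (hσ : ∀ t : ℕ, σ ≤ t ↔ e ≤ t ∨ p t) {t : ℕ} (h : σ = t) : e = t ∨ p t := by
  refine ((hσ t).1 h.le).imp_left fun he => he.antisymm ?_
  obtain ⟨s, rfl⟩ := WithTop.ne_top_iff_exists.1 (he.trans_lt (WithTop.coe_lt_top t)).ne
  exact h.symm.le.trans ((hσ s).2 (.inl le_rfl))

end RandomTime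

namespace IsNonanticipating

variable {S : Type*} {p : ℕ → (ℕ → S) → Prop}

theorem firstTime_le (hp : IsNonanticipating p) :
    IsNonanticipating fun t x => firstTime (fun s => p s x) ≤ t := by
  intro t x y hxy
  simp only [firstTime_le_iff]
  exact propext (exists_congr fun s => and_congr_right fun hs =>
    (hp.dependsOn_of_le hs hxy).to_iff)

theorem count [∀ t x, Decidable (p t x)] (hp : IsNonanticipating p) :
    IsNonanticipating fun t x => Nat.count (fun s => p (s + 1) x) t := by
  intro t x y hxy
  simp only [Nat.count_eq_card_filter_range]
  exact congrArg _ (Finset.filter_congr fun s hs =>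
    (hp.dependsOn_of_le (Finset.mem_range.1 hs) hxy).to_iff)

end IsNonanticipating

theorem le_map_apply {α β : Type*} (p : PMF α) (f : α → β) (a : α) : p a ≤ p.map f (f a) := by
  classical
  rw [PMF.map_apply]
  exact (if_pos rfl).symm.le.trans (ENNReal.le_tsum a)

instance {V : Type*} : MeasurableSingletonClass (PartialTree V) := ⟨fun _ => trivial⟩

instance {V : Type*} [Countable V] : Countable (PartialTree V) := by
  have : Function.Injective fun T : PartialTree V => (T.verts, T.edges) :=
    fun _ _ h => PartialTree.ext (congrArg Prod.fst h) (congrArg Prod.snd h)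
  exact this.countable

namespace Wilson

instance {V : Type*} [Countable V] : Countable (State V) := by
  have : Function.Injective fun s : State V => (s.tree, s.walk) :=
    fun _ _ h => State.ext (congrArg Prod.fst h) (congrArg Prod.snd h)
  exact this.countable

section LoopErase

variable {V : Type*} [DecidableEq V]

theorem loopErase_ne_nil {w : List V} (hw : w ≠ []) : loopErase w ≠ [] := by
  obtain ⟨w, x, rfl⟩ := (List.eq_nil_or_concat' w).resolve_left hw
  rw [loopErase_append]
  exact loopStep_ne_nil _ x

theorem nodup_loopErase (w : List V) : (loopErase w).Nodup := by
  induction w using List.reverseRecOn with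
  | nil => exact List.nodup_nil
  | append_singleton w x ih => exact loopErase_append w x ▸ nodup_loopStep ih x

theorem loopErase_subset (w : List V) : loopErase w ⊆ w := by
  induction w using List.reverseRecOn with
  | nil => exact List.Subset.refl _
  | append_singleton w x ih =>
    intro y hy
    rw [loopErase_append] at hy
    exact List.mem_append.2 ((mem_or_eq_of_mem_loopStep hy).imp (@ih y) List.mem_singleton.2)

end LoopErase

section Reachable

variable {V : Type*} {s : State V} {r : V}

/-- The states in which Wilson's algorithm with root `r` can be. -/
def Reachable (r : V) (s : State V) : Prop :=
  r ∈ s.tree.verts ∧ ∀ y ∈ s.walk, y ∉ s.tree.verts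

theorem reachable_init (r : V) : Reachable r (init r) :=
  ⟨Finset.mem_singleton_self r, fun _ hy => absurd hy List.not_mem_nil⟩

theorem Reachable.advance [DecidableEq V] (h : Reachable r s) (x : V) :
    Reachable r (advance s x) := by
  rw [Wilson.advance]
  split_ifs with hx
  · exact ⟨Finset.mem_union_left _ h.1, fun _ hy => absurd hy List.not_mem_nil⟩
  · exact ⟨h.1, List.forall_mem_append.2 ⟨h.2, by simpa using hx⟩⟩

end Reachable

section Step

variable {V : Type*} [Fintype V] [DecidableEq V] (G : LoopGraph V) {s s' : State V} {r : V}

theorem step_of_verts_eq_univ (hs : s.tree.verts = Finset.univ) : step G s = PMF.pure s := by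
  rw [step, dif_neg (by simp [hs])]

theorem step_of_walk_eq_nil (hs : s.tree.vertsᶜ.Nonempty) (hw : s.walk = []) :
    step G s = (PMF.uniformOfFinset _ hs).map fun v => ⟨s.tree, [v]⟩ := by
  rw [step, dif_pos hs]
  simp [hw]

theorem step_of_walk_ne_nil (hs : s.tree.vertsᶜ.Nonempty) (hw : s.walk ≠ []) :
    step G s = (G.step (s.walk.getLast hw)).map (advance s) := by
  rw [step, dif_pos hs]
  simp [List.getLast?_eq_getLast_of_ne_nil hw]

theorem Reachable.step (h : Reachable r s) (hs : step G s s' ≠ 0) : Reachable r s' := by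
  rcases Finset.eq_empty_or_nonempty s.tree.vertsᶜ with hspan | hspan
  · rw [step_of_verts_eq_univ G (by simpa using hspan), ← PMF.mem_support_iff,
      PMF.mem_support_pure_iff] at hs
    rwa [hs]
  by_cases hw : s.walk = []
  · rw [step_of_walk_eq_nil G hspan hw, ← PMF.mem_support_iff, PMF.mem_support_map_iff] at hs
    obtain ⟨v, hv, rfl⟩ := hs
    rw [PMF.mem_support_uniformOfFinset_iff] at hv
    exact ⟨h.1, by simpa using hv⟩
  · rw [step_of_walk_ne_nil G hspan hw, ← PMF.mem_support_iff, PMF.mem_support_map_iff] at hs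
    obtain ⟨v, -, rfl⟩ := hs
    exact h.advance v

end Step

section Potential

variable {V : Type*} [Fintype V] [DecidableEq V] {s s' : State V} {r : V}

/-- The number of vertices outside the tree, counted twice, plus `1` if no walk is under way. -/
def potential (s : State V) : ℕ := 2 * s.tree.vertsᶜ.card + if s.walk = [] then 1 else 0

theorem potential_advance_of_notMem (hw : s.walk ≠ []) {x : V} (hx : x ∉ s.tree.verts) :
    potential (advance s x) = potential s := by
  rw [potential, potential, advance, if_neg hx, if_neg hw, if_neg (by simp)]

theorem potential_advance_lt (hs : Reachable r s) (hw : s.walk ≠ []) {x : V}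
    (hx : x ∈ s.tree.verts) : potential (advance s x) < potential s := by
  obtain ⟨v, hv⟩ := List.exists_mem_of_ne_nil _ (loopErase_ne_nil hw)
  have hv_notMem : v ∉ s.tree.verts := hs.2 v (loopErase_subset _ hv)
  have hx_notMem : x ∉ loopErase s.walk := fun h => hs.2 x (loopErase_subset _ h) hx
  have hlt : (advance s x).tree.vertsᶜ.card < s.tree.vertsᶜ.card := by
    refine Finset.card_lt_card (Finset.compl_ssubset_compl.2 ?_)
    rw [advance, if_pos hx, loopErase_append, loopStep_of_notMem hx_notMem]
    refine (Finset.ssubset_iff_of_subset Finset.subset_union_left).2 ⟨v, ?_, hv_notMem⟩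
    exact Finset.mem_union_right _ (by simp [hv])
  rw [potential, potential, if_neg hw]
  split_ifs <;> lia

theorem tsum_step_mul_potential_add_le [Nonempty V] (hs : Reachable r s)
    (hspan : s.tree.vertsᶜ.Nonempty) :
    ∑' s', step (LoopGraph.complete V) s s' * (potential s' : ℝ≥0∞) + (Fintype.card V : ℝ≥0∞)⁻¹ ≤
      potential s := by
  by_cases hw : s.walk = []
  · have hlt (v : V) : potential ⟨s.tree, [v]⟩ < potential s := by simp [potential, hw]
    rw [step_of_walk_eq_nil _ hspan hw]
    obtain ⟨v, hv⟩ := Finset.nonempty_def.1 hspan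
    refine tsum_mul_add_le_of_exists _ (fun s' hs' => ?_) ⟨⟨s.tree, [v]⟩, ?_, hlt v⟩
    · obtain ⟨u, -, rfl⟩ := (PMF.mem_support_map_iff _ _ _).1 ((PMF.mem_support_iff _ _).2 hs')
      exact (hlt u).le
    · refine le_trans ?_ (le_map_apply _ (fun v => (⟨s.tree, [v]⟩ : State V)) v)
      rw [PMF.uniformOfFinset_apply_of_mem _ hv, ENNReal.inv_le_inv]
      exact Nat.cast_le.2 (Finset.card_le_univ _)
  · rw [step_of_walk_ne_nil _ hspan hw, LoopGraph.complete_step_eq_uniformOfFintype]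
    refine tsum_mul_add_le_of_exists _ (fun s' hs' => ?_)
      ⟨advance s r, ?_, potential_advance_lt hs hw hs.1⟩
    · obtain ⟨x, -, rfl⟩ := (PMF.mem_support_map_iff _ _ _).1 ((PMF.mem_support_iff _ _).2 hs')
      by_cases hx : x ∈ s.tree.verts
      · exact (potential_advance_lt hs hw hx).le
      · exact (potential_advance_of_notMem hw hx).le
    · exact (PMF.uniformOfFintype_apply r).symm.le.trans (le_map_apply _ (advance s) r)

end Potential

section StateLaw

variable {V : Type*} [Fintype V] [DecidableEq V] [Nonempty V] {s : State V} {r : V}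

/-- The conditional law, given the present state, of the tree after the completion of `k` more
branches. -/
def stateLaw : ℕ → State V → PMF (PartialTree V)
  | 0, s => PMF.pure s.tree
  | k + 1, s => if h : s.tree.verts.Nonempty ∧ s.walk ≠ []
      then (walkLaw s.tree h.1 (loopErase s.walk)).bind (branchesLaw k)
      else branchesLaw (k + 1) s.tree

theorem stateLaw_of_walk_eq_nil (hw : s.walk = []) (k : ℕ) :
    stateLaw k s = branchesLaw k s.tree := by
  cases k with
  | zero => rfl
  | succ k => exact dif_neg fun h => h.2 hw

theorem stateLaw_of_walk_ne_nil (hT : s.tree.verts.Nonempty) (hw : s.walk ≠ []) (k : ℕ) :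
    stateLaw (k + 1) s = (walkLaw s.tree hT (loopErase s.walk)).bind (branchesLaw k) :=
  dif_pos ⟨hT, hw⟩

theorem stateLaw_of_verts_eq_univ (hs : Reachable r s) (hspan : s.tree.verts = Finset.univ)
    (k : ℕ) : stateLaw k s = PMF.pure s.tree := by
  have hw : s.walk = [] := List.eq_nil_iff_forall_not_mem.2 fun x hx => hs.2 x hx (by simp [hspan])
  rw [stateLaw_of_walk_eq_nil hw, branchesLaw_of_verts_eq_univ hspan]

theorem stateLaw_succ_eq_bind (hs : Reachable r s) (hspan : s.tree.vertsᶜ.Nonempty) (k : ℕ) :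
    stateLaw (k + 1) s = (step (LoopGraph.complete V) s).bind fun s' =>
      stateLaw (if s'.walk = [] then k else k + 1) s' := by
  have hT : s.tree.verts.Nonempty := ⟨r, hs.1⟩
  by_cases hw : s.walk = []
  · rw [stateLaw_of_walk_eq_nil hw, step_of_walk_eq_nil _ hspan hw, PMF.bind_map, branchesLaw,
      ← uniformOfFinset_bind_walkLaw hT hspan, PMF.bind_bind]
    refine congrArg _ (funext fun v => ?_)
    simp [stateLaw, hT, loopErase]
  · rw [stateLaw_of_walk_ne_nil hT hw, step_of_walk_ne_nil _ hspan hw,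
      LoopGraph.complete_step_eq_uniformOfFintype, PMF.bind_map,
      walkLaw_eq_bind hT (loopErase_ne_nil hw) (nodup_loopErase _)
        fun x hx => hs.2 x (loopErase_subset _ hx), PMF.bind_bind]
    refine congrArg _ (funext fun x => ?_)
    rw [Function.comp_apply, advance, ← loopErase_append]
    by_cases hx : x ∈ s.tree.verts
    · simp only [if_pos hx, PMF.pure_bind, if_true]
      exact (stateLaw_of_walk_eq_nil (s := ⟨_, []⟩) rfl k).symm
    · have hne : s.walk ++ [x] ≠ [] := by simp
      simp only [if_neg hx, if_neg hne]
      exact (stateLaw_of_walk_ne_nil (s := ⟨s.tree, s.walk ++ [x]⟩) hT hne k).symm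

end StateLaw

section Run

variable {V : Type*} {w : ℕ → State V}

/-- The number of branches that are completed by time `t` along the run `w`. -/
def branchCount (w : ℕ → State V) (t : ℕ) : ℕ := Nat.count (fun s => (w (s + 1)).walk = []) t

theorem isNonanticipating_tree : IsNonanticipating fun t (w : ℕ → State V) => (w t).tree :=
  fun t _ _ hxy => congrArg State.tree (hxy t Set.self_mem_Iic)

theorem isNonanticipating_branchCount :
    IsNonanticipating fun t (w : ℕ → State V) => branchCount w t :=
  IsNonanticipating.count (p := fun t (w : ℕ → State V) => (w t).walk = [])
    fun t _ _ hxy => congrArg (fun s : State V => s.walk = []) (hxy t Set.self_mem_Iic)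

variable [Fintype V]

theorem isNonanticipating_endTime_le :
    IsNonanticipating fun t (w : ℕ → State V) => endTime w ≤ t :=
  IsNonanticipating.firstTime_le (p := fun t (w : ℕ → State V) => (w t).tree.verts = Finset.univ)
    fun t _ _ hxy => congrArg (fun s : State V => s.tree.verts = Finset.univ)
      (hxy t Set.self_mem_Iic)

theorem sigmaHat_le_iff {i t : ℕ} : sigmaHat w i ≤ t ↔ endTime w ≤ t ∨ i ≤ branchCount w t :=
  le_natCast_iff_of_succ_eq_firstTime (σ := sigmaHat w) (p := fun t => (w t).walk = []) rfl
    (fun _ => rfl) i t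

theorem isNonanticipating_sigmaHat_le (i : ℕ) :
    IsNonanticipating fun t (w : ℕ → State V) => sigmaHat w i ≤ t := by
  intro t x y hxy
  simp only [sigmaHat_le_iff]
  exact congrArg₂ Or (isNonanticipating_endTime_le t hxy)
    (congrArg (i ≤ ·) (isNonanticipating_branchCount t hxy))

theorem verts_compl_nonempty_of_not_endTime_le [DecidableEq V] {t : ℕ} (h : ¬endTime w ≤ t) :
    (w t).tree.vertsᶜ.Nonempty := by
  rw [Finset.nonempty_iff_ne_empty, ne_eq, Finset.compl_eq_empty_iff]
  exact fun hspan => h (firstTime_le_iff.2 ⟨t, le_rfl, hspan⟩)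

end Run

section Chain

variable {V : Type*} [Fintype V] [DecidableEq V] {r : V} {Ω : Type*} [MeasurableSpace Ω]
  {Q : Measure Ω} [IsProbabilityMeasure Q] {W : ℕ → Ω → State V}

theorem ae_reachable {G : LoopGraph V} (hW : IsMarkovChain Q (step G) (init r) W) :
    ∀ᵐ ω ∂Q, ∀ t, Reachable r (W t ω) :=
  hW.ae_invariant (reachable_init r) fun _ _ h hs => h.step G hs

theorem ae_endTime_lt_top (hW : IsMarkovChain Q (step (LoopGraph.complete V)) (init r) W) :
    ∀ᵐ ω ∂Q, endTime (fun t => W t ω) < ⊤ := by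
  have : Nonempty V := ⟨r⟩
  refine hW.ae_lt_top_of_drift (ε := (Fintype.card V : ℝ≥0∞)⁻¹) isNonanticipating_endTime_le
    (Z := fun t w => potential (w t)) (fun t x y hxy => congrArg _ (hxy t Set.self_mem_Iic))
    (by simp) ?_
  filter_upwards [ae_reachable hW] with ω hω t ht
  simpa using tsum_step_mul_potential_add_le (hω t)
    (verts_compl_nonempty_of_not_endTime_le ht.not_ge)

theorem ae_sigmaHat_lt_top (hW : IsMarkovChain Q (step (LoopGraph.complete V)) (init r) W)
    (i : ℕ) : ∀ᵐ ω ∂Q, sigmaHat (fun t => W t ω) i < ⊤ := by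
  filter_upwards [ae_endTime_lt_top hW] with ω hω
  obtain ⟨t, ht⟩ := WithTop.ne_top_iff_exists.1 hω.ne
  exact (sigmaHat_le_iff.2 (.inl ht.symm.le)).trans_lt (WithTop.coe_lt_top t)

variable [Nonempty V]

theorem stateLaw_eq_bind_update {w : ℕ → State V} {i t : ℕ} (hw : Reachable r (w t))
    (ht : ¬sigmaHat w i ≤ t) :
    stateLaw (i - branchCount w t) (w t) =
      (step (LoopGraph.complete V) (w t)).bind fun s =>
        stateLaw (i - branchCount (Function.update w (t + 1) s) (t + 1)) s := by
  obtain ⟨hend, hcount⟩ := not_or.1 (mt sigmaHat_le_iff.2 ht)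
  obtain ⟨k, hk⟩ := Nat.exists_eq_add_of_lt (not_le.1 hcount)
  have hupdate (s : State V) : i - branchCount (Function.update w (t + 1) s) (t + 1) =
      if s.walk = [] then k else k + 1 := by
    rw [branchCount, Nat.count_succ, ← branchCount,
      isNonanticipating_branchCount.update_of_le le_rfl, Function.update_self, hk]
    split_ifs <;> lia
  simp only [hupdate]
  rw [← stateLaw_succ_eq_bind hw (verts_compl_nonempty_of_not_endTime_le hend)]
  exact congrArg (stateLaw · _) (by lia)

theorem map_stoppedValue_sigmaHat (hW : IsMarkovChain Q (step (LoopGraph.complete V)) (init r) W)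
    (i : ℕ) :
    Q.map (stoppedValue (fun t ω => (W t ω).tree) fun ω => sigmaHat (fun t => W t ω) i) =
      (branchesLaw i ⟨{r}, ∅⟩).toMeasure := by
  have hL : IsNonanticipating fun t (w : ℕ → State V) =>
      stateLaw (i - branchCount w t) (w t) := fun t _ _ hxy =>
    congrArg₂ (fun n => stateLaw (i - n)) (isNonanticipating_branchCount t hxy)
      (hxy t Set.self_mem_Iic)
  rw [hW.map_stoppedValue_eq_toMeasure (isNonanticipating_sigmaHat_le i) hL isNonanticipating_tree
    (ae_sigmaHat_lt_top hW i) ?_ ?_]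
  · have hstart : stateLaw i (init r) = branchesLaw i ⟨{r}, ∅⟩ := stateLaw_of_walk_eq_nil rfl i
    exact congrArg PMF.toMeasure hstart
  · filter_upwards [ae_reachable hW] with ω hω t ht
    rcases eq_or_le_of_eq_natCast (fun _ => sigmaHat_le_iff) ht with hend | hcount
    · exact stateLaw_of_verts_eq_univ (hω t) (prop_of_firstTime_eq hend) _
    · rw [Nat.sub_eq_zero_of_le hcount, stateLaw]
  · filter_upwards [ae_reachable hW] with ω hω t ht
    simpa only [Function.update_self] using stateLaw_eq_bind_update (hω t) ht.not_ge

end Chain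

end Wilson

namespace AldousBroder

section Trajectory

variable {V : Type*} [DecidableEq V] {x : ℕ → V} {t : ℕ}

/-- The walk visits its position at time `t` for the first time, and `t ≠ 0`: the convention
`0 - 1 = 0` makes this false at `t = 0`, since the root does not belong to a branch. -/
def Fresh (x : ℕ → V) (t : ℕ) : Prop := x t ∉ visited x (t - 1)

instance : Decidable (Fresh x t) := inferInstanceAs (Decidable (x t ∉ visited x (t - 1)))

/-- The number of branches that end by time `t`. -/
def branchCount (x : ℕ → V) (t : ℕ) : ℕ := Nat.count (fun s => Fresh x s ∧ ¬Fresh x (s + 1)) t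

theorem mem_visited_self (x : ℕ → V) (t : ℕ) : x t ∈ visited x t :=
  Finset.mem_image_of_mem x (Finset.self_mem_range_succ t)

theorem visited_succ (x : ℕ → V) (t : ℕ) :
    visited x (t + 1) = insert (x (t + 1)) (visited x t) := by
  rw [visited, Finset.range_add_one, Finset.image_insert, visited]

theorem tree_succ (x : ℕ → V) (t : ℕ) :
    tree x (t + 1) = if x (t + 1) ∈ visited x t then tree x t
      else (tree x t).grow (x t) (x (t + 1)) := by
  split_ifs with h <;>
    simp [tree, PartialTree.grow, visited_succ, Finset.range_add_one, Finset.filter_insert, h]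

theorem isNonanticipating_visited : IsNonanticipating fun t (x : ℕ → V) => visited x t :=
  fun _ _ _ hxy => Finset.image_congr fun k hk =>
    hxy k (Nat.le_of_lt_succ (Finset.mem_range.1 (Finset.mem_coe.1 hk)))

theorem isNonanticipating_fresh : IsNonanticipating fun t (x : ℕ → V) => Fresh x t :=
  fun t _ _ hxy => congrArg₂ (fun a T => a ∉ T) (hxy t Set.self_mem_Iic)
    (isNonanticipating_visited.dependsOn_of_le (Nat.sub_le t 1) hxy)

theorem isNonanticipating_tree : IsNonanticipating fun t (x : ℕ → V) => tree x t := by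
  intro t x y hxy
  induction t with
  | zero => simp [tree, isNonanticipating_visited 0 hxy]
  | succ t ih =>
    have hxy' : ∀ k ∈ Set.Iic t, x k = y k := fun k hk => hxy k (Nat.le_succ_of_le hk)
    have htree : tree x t = tree y t := ih hxy'
    simp only [tree_succ]
    rw [htree, show visited x t = visited y t from isNonanticipating_visited t hxy',
      hxy' t Set.self_mem_Iic, hxy (t + 1) Set.self_mem_Iic]

theorem isNonanticipating_branchCount :
    IsNonanticipating fun t (x : ℕ → V) => branchCount x t :=
  IsNonanticipating.count (p := fun t (x : ℕ → V) => Fresh x (t - 1) ∧ ¬Fresh x t)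
    fun t _ _ hxy => congrArg₂ (fun a b => a ∧ ¬b)
      (isNonanticipating_fresh.dependsOn_of_le (Nat.sub_le t 1) hxy) (isNonanticipating_fresh t hxy)

theorem exists_fresh_not_fresh_iff {σ : WithTop ℕ} (hσ : ∀ s < t, σ = s → ¬Fresh x s) :
    (∃ v ≤ t, (∃ u < v, σ < u ∧ Fresh x u) ∧ ¬Fresh x v) ↔
      ∃ v ≤ t, σ < v ∧ Fresh x (v - 1) ∧ ¬Fresh x v := by
  constructor
  · rintro ⟨v, hvt, ⟨u, huv, hσu, hu⟩, hv⟩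
    induction v, huv using Nat.le_induction with
    | base => exact ⟨u + 1, hvt, hσu.trans (Nat.cast_lt.2 u.lt_succ_self), hu, hv⟩
    | succ v huv ih =>
      by_cases hv' : Fresh x v
      · exact ⟨v + 1, hvt, hσu.trans (Nat.cast_lt.2 (Nat.lt_succ_of_lt huv)), hv', hv⟩
      · exact ih (Nat.le_of_succ_le hvt) hv'
  · rintro ⟨v, hvt, hσv, hu, hv⟩
    obtain ⟨v, rfl⟩ := Nat.exists_eq_succ_of_ne_zero (n := v) (by rintro rfl; exact hv hu)
    have hσ_lt := (lt_natCast_succ_iff.1 hσv).lt_of_ne fun h => hσ v hvt h hu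
    exact ⟨v + 1, hvt, ⟨v, v.lt_succ_self, hσ_lt, hu⟩, hv⟩

end Trajectory

section Times

variable {V : Type*} [Fintype V] [DecidableEq V] {x : ℕ → V} {t : ℕ}

theorem isNonanticipating_coverTime_le :
    IsNonanticipating fun t (x : ℕ → V) => coverTime x ≤ t :=
  IsNonanticipating.firstTime_le (p := fun t (x : ℕ → V) => visited x t = Finset.univ)
    fun t _ _ hxy => congrArg (· = Finset.univ) (isNonanticipating_visited t hxy)

theorem sigmaIn_le_coverTime (x : ℕ → V) (i : ℕ) : sigmaIn x i ≤ coverTime x := by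
  cases i with
  | zero => exact zero_le
  | succ i => exact inf_le_right

theorem not_fresh_of_sigmaIn_eq {i s : ℕ} (h : sigmaIn x i = s) (hs : s < coverTime x) :
    ¬Fresh x s := by
  cases i with
  | zero =>
    obtain rfl : 0 = s := Nat.cast_inj.1 h
    exact not_not.2 (mem_visited_self x 0)
  | succ i =>
    rw [sigmaIn, inTime] at h
    have hfirst := (min_choice _ _).resolve_right fun h' => hs.ne (h.symm.trans h')
    exact not_not.2 (prop_of_firstTime_eq (hfirst.symm.trans h)).2

theorem sigmaIn_succ (x : ℕ → V) (i : ℕ) :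
    sigmaIn x (i + 1) =
      firstTime (fun t => sigmaIn x i < t ∧ Fresh x (t - 1) ∧ ¬Fresh x t) ⊓ coverTime x := by
  have hle (t : ℕ) : sigmaIn x (i + 1) ≤ t ↔
      firstTime (fun t => sigmaIn x i < t ∧ Fresh x (t - 1) ∧ ¬Fresh x t) ⊓ coverTime x ≤ t := by
    rw [sigmaIn, inTime, inf_le_iff, inf_le_iff, or_comm, or_comm (a := firstTime _ ≤ _)]
    refine or_congr_right' fun hcover => ?_
    have hout {v : ℕ} (hv : v ≤ t) : outTime x (sigmaIn x i) < v ↔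
        ∃ u < v, sigmaIn x i < u ∧ Fresh x u := by
      cases v with
      | zero => simp
      | succ v =>
        have hcover' : ¬coverTime x ≤ v := fun h => hcover (h.trans (Nat.cast_le.2 (by lia)))
        rw [lt_natCast_succ_iff, outTime, inf_le_iff, or_iff_left hcover', firstTime_le_iff]
        simp only [Nat.lt_succ_iff]
        rfl
    rw [firstTime_le_iff, firstTime_le_iff, ← exists_fresh_not_fresh_iff fun s hs h =>
      not_fresh_of_sigmaIn_eq h (not_le.1 fun h' => hcover (h'.trans (Nat.cast_le.2 hs.le)))]
    refine exists_congr fun v => and_congr_right fun hv => ?_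
    rw [hout hv, Fresh, not_not]
  refine eq_of_forall_ge_iff fun c => ?_
  induction c using WithTop.recTopCoe with
  | top => simp
  | coe t => exact hle t

theorem sigmaIn_le_iff {i : ℕ} : sigmaIn x i ≤ t ↔ coverTime x ≤ t ∨ i ≤ branchCount x t :=
  le_natCast_iff_of_succ_eq_firstTime (σ := sigmaIn x) (p := fun t => Fresh x (t - 1) ∧ ¬Fresh x t)
    rfl (sigmaIn_succ x) i t

theorem isNonanticipating_sigmaIn_le (i : ℕ) :
    IsNonanticipating fun t (x : ℕ → V) => sigmaIn x i ≤ t := by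
  intro t x y hxy
  simp only [sigmaIn_le_iff]
  exact congrArg₂ Or (isNonanticipating_coverTime_le t hxy)
    (congrArg (i ≤ ·) (isNonanticipating_branchCount t hxy))

end Times

section Law

variable {V : Type*} [Fintype V] [DecidableEq V] [Nonempty V] {x : ℕ → V} {i t : ℕ}

/-- The conditional law, given the trajectory up to time `t`, of the tree at the end of the `i`-th
branch. -/
def pathLaw (i t : ℕ) (x : ℕ → V) : PMF (PartialTree V) :=
  if Fresh x t then growingLaw (i - branchCount x t - 1) (tree x t) (x t)
  else idleLaw (i - branchCount x t) (tree x t) (x t)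

theorem isNonanticipating_pathLaw (i : ℕ) : IsNonanticipating (pathLaw (V := V) i) := by
  intro t x y hxy
  simp only [pathLaw, isNonanticipating_branchCount t hxy, isNonanticipating_tree t hxy,
    hxy t Set.self_mem_Iic, (isNonanticipating_fresh t hxy).to_iff]

theorem pathLaw_zero_const (i : ℕ) (r : V) : pathLaw i 0 (fun _ => r) = branchesLaw i ⟨{r}, ∅⟩ := by
  have htree : tree (fun _ => r) 0 = ⟨{r}, ∅⟩ := rfl
  have hroot : ¬Fresh (fun _ : ℕ => r) 0 := not_not.2 (mem_visited_self _ 0)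
  have hpure : PMF.uniformOfFinset {r} (Finset.singleton_nonempty r) = PMF.pure r := by
    ext s
    simp [PMF.pure_apply]
  rw [pathLaw, if_neg hroot, htree, ← uniformOfFinset_bind_idleLaw (Finset.singleton_nonempty r),
    hpure, PMF.pure_bind]
  rfl

theorem pathLaw_of_sigmaIn_eq (h : sigmaIn x i = t) : pathLaw i t x = PMF.pure (tree x t) := by
  rcases eq_or_ne (coverTime x) t with hcover | hcover
  · have hspan : (tree x t).verts = Finset.univ := prop_of_firstTime_eq hcover
    rw [pathLaw, growingLaw_of_verts_eq_univ hspan, idleLaw_of_verts_eq_univ hspan, ite_self]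
  · have hcount := (eq_or_le_of_eq_natCast (fun _ => sigmaIn_le_iff) h).resolve_left hcover
    have hlt : t < coverTime x := (h ▸ sigmaIn_le_coverTime x i).lt_of_ne hcover.symm
    rw [pathLaw, if_neg (not_fresh_of_sigmaIn_eq h hlt), Nat.sub_eq_zero_of_le hcount, idleLaw]

theorem pathLaw_update_succ (i t : ℕ) (x : ℕ → V) (s : V) :
    pathLaw i (t + 1) (Function.update x (t + 1) s) =
      if s ∈ visited x t then
        idleLaw (i - branchCount x t - if Fresh x t then 1 else 0) (tree x t) s
      else growingLaw (i - branchCount x t - 1) ((tree x t).grow (x t) s) s := by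
  have hfresh : Fresh (Function.update x (t + 1) s) (t + 1) ↔ s ∉ visited x t := by
    rw [Fresh, Nat.add_sub_cancel, isNonanticipating_visited.update_of_le le_rfl,
      Function.update_self]
  have hfresh' := (isNonanticipating_fresh.update_of_le le_rfl x s (s := t)).to_iff
  rw [pathLaw, branchCount, Nat.count_succ, ← branchCount,
    isNonanticipating_branchCount.update_of_le le_rfl, tree_succ,
    isNonanticipating_visited.update_of_le le_rfl, isNonanticipating_tree.update_of_le le_rfl,
    Function.update_self, Function.update_of_ne t.lt_succ_self.ne]
  simp only [hfresh, hfresh']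
  by_cases hs : s ∈ visited x t <;> simp [hs, Nat.sub_sub]

theorem pathLaw_eq_bind (ht : ¬sigmaIn x i ≤ t) :
    pathLaw i t x = ((LoopGraph.complete V).step (x t)).bind fun s =>
      pathLaw i (t + 1) (Function.update x (t + 1) s) := by
  obtain ⟨-, hcount⟩ := not_or.1 (mt sigmaIn_le_iff.2 ht)
  obtain ⟨k, hk⟩ : ∃ k, i - branchCount x t = k + 1 := ⟨i - branchCount x t - 1, by lia⟩
  have hx : x t ∈ (tree x t).verts := mem_visited_self x t
  rw [pathLaw, LoopGraph.complete_step_eq_uniformOfFintype]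
  simp only [pathLaw_update_succ, hk]
  split_ifs
  · exact growingLaw_eq_bind k hx
  · exact idleLaw_succ_eq_bind k hx

end Law

section Chain

variable {V : Type*} [Fintype V] [DecidableEq V] [Nonempty V] {r : V} {Ω : Type*}
  [MeasurableSpace Ω] {P : Measure Ω} [IsProbabilityMeasure P] {X : ℕ → Ω → V}

theorem tsum_step_mul_card_compl_visited_add_le {x : ℕ → V} {t : ℕ} (ht : ¬coverTime x ≤ t) :
    ∑' s, (LoopGraph.complete V).step (x t) s *
        ((visited (Function.update x (t + 1) s) (t + 1))ᶜ.card : ℝ≥0∞) +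
      (Fintype.card V : ℝ≥0∞)⁻¹ ≤ (visited x t)ᶜ.card := by
  have hvisited (s : V) :
      visited (Function.update x (t + 1) s) (t + 1) = insert s (visited x t) := by
    rw [visited_succ, isNonanticipating_visited.update_of_le le_rfl, Function.update_self]
  have hne : visited x t ≠ Finset.univ := fun h => ht (firstTime_le_iff.2 ⟨t, le_rfl, h⟩)
  obtain ⟨v, hv⟩ := not_forall.1 (mt Finset.eq_univ_iff_forall.2 hne)
  rw [LoopGraph.complete_step_eq_uniformOfFintype]
  simp only [hvisited]
  refine tsum_mul_add_le_of_exists _ (fun s _ => ?_)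
    ⟨v, (PMF.uniformOfFintype_apply v).symm.le, ?_⟩
  · exact Finset.card_le_card (Finset.compl_subset_compl.2 (Finset.subset_insert s _))
  · exact Finset.card_lt_card (Finset.compl_ssubset_compl.2 (Finset.ssubset_insert hv))

theorem ae_coverTime_lt_top (hX : IsMarkovChain P (LoopGraph.complete V).step r X) :
    ∀ᵐ ω ∂P, coverTime (fun t => X t ω) < ⊤ := by
  have hcard : IsNonanticipating fun t (x : ℕ → V) => (visited x t)ᶜ.card :=
    fun t _ _ hxy => congrArg (fun T : Finset V => Tᶜ.card) (isNonanticipating_visited t hxy)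
  exact hX.ae_lt_top_of_drift isNonanticipating_coverTime_le hcard
    (ENNReal.inv_ne_zero.2 (ENNReal.natCast_ne_top _))
    (ae_of_all P fun ω t ht =>
      tsum_step_mul_card_compl_visited_add_le (x := fun k => X k ω) (t := t) ht.not_ge)

theorem ae_sigmaIn_lt_top (hX : IsMarkovChain P (LoopGraph.complete V).step r X) (i : ℕ) :
    ∀ᵐ ω ∂P, sigmaIn (fun t => X t ω) i < ⊤ := by
  filter_upwards [ae_coverTime_lt_top hX] with ω hω
  obtain ⟨t, ht⟩ := WithTop.ne_top_iff_exists.1 hω.ne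
  exact (sigmaIn_le_iff.2 (.inl ht.symm.le)).trans_lt (WithTop.coe_lt_top t)

theorem map_stoppedValue_sigmaIn (hX : IsMarkovChain P (LoopGraph.complete V).step r X) (i : ℕ) :
    P.map (stoppedValue (fun t ω => tree (fun k => X k ω) t) fun ω => sigmaIn (fun t => X t ω) i) =
      (branchesLaw i ⟨{r}, ∅⟩).toMeasure := by
  rw [← pathLaw_zero_const]
  exact hX.map_stoppedValue_eq_toMeasure (isNonanticipating_sigmaIn_le i)
    (isNonanticipating_pathLaw i) isNonanticipating_tree (ae_sigmaIn_lt_top hX i)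
    (ae_of_all P fun _ _ h => pathLaw_of_sigmaIn_eq h)
    (ae_of_all P fun _ _ ht => pathLaw_eq_bind ht.not_ge)

end Chain

end AldousBroder

end

theorem mainTheorem1 {V : Type*} [Fintype V] [DecidableEq V] (r : V)
    {Ω : Type*} [MeasurableSpace Ω] (P : Measure Ω) [IsProbabilityMeasure P]
    {Ω' : Type*} [MeasurableSpace Ω'] (Q : Measure Ω') [IsProbabilityMeasure Q]
    (X : ℕ → Ω → V) (hX : IsMarkovChain P (LoopGraph.complete V).step r X)
    (W : ℕ → Ω' → Wilson.State V)
    (hW : IsMarkovChain Q (Wilson.step (LoopGraph.complete V)) (Wilson.init r) W) :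
    (∀ i, IsStoppingTime (pastFiltration W hW.measurable)
        (fun ω => Wilson.sigmaHat (fun t => W t ω) i)) ∧
    (∀ i, IsStoppingTime (pastFiltration X hX.measurable)
        (fun ω => AldousBroder.sigmaIn (fun t => X t ω) i)) ∧
    (∀ i, ∀ᵐ ω ∂Q, Wilson.sigmaHat (fun t => W t ω) i < ⊤) ∧
    (∀ i, ∀ᵐ ω ∂P, AldousBroder.sigmaIn (fun t => X t ω) i < ⊤) ∧
    ∀ i, IdentDistrib
      (stoppedValue (fun t ω => (W t ω).tree) (fun ω => Wilson.sigmaHat (fun t => W t ω) i))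
      (stoppedValue (fun t ω => AldousBroder.tree (fun k => X k ω) t)
        (fun ω => AldousBroder.sigmaIn (fun t => X t ω) i))
      Q P := by
  have : Nonempty V := ⟨r⟩
  have hsigmaHat := Wilson.isNonanticipating_sigmaHat_le (V := V)
  have hsigmaIn := AldousBroder.isNonanticipating_sigmaIn_le (V := V)
  have htreeW := Wilson.isNonanticipating_tree (V := V)
  have htreeAB := AldousBroder.isNonanticipating_tree (V := V)
  refine ⟨fun i => (hsigmaHat i).isStoppingTime hW.measurable,
    fun i => (hsigmaIn i).isStoppingTime hX.measurable,
    Wilson.ae_sigmaHat_lt_top hW, AldousBroder.ae_sigmaIn_lt_top hX, fun i => ⟨?_, ?_, ?_⟩⟩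
  · exact (htreeW.measurable_stoppedValue (hsigmaHat i) hW.measurable).aemeasurable
  · exact (htreeAB.measurable_stoppedValue (hsigmaIn i) hX.measurable).aemeasurable
  · exact (Wilson.map_stoppedValue_sigmaHat hW i).trans
      (AldousBroder.map_stoppedValue_sigmaIn hX i).symm
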